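/- **Theorem (Watson's $q$-analogue of Whipple's transformation).** Let $q\in\mathbb C$ with $|q|<1$. For $x\in\mathbb C$ and $n\ge 0$ put $(x;q)_n=\prod_{k=0}^{n-1}(1-xq^k)$, $(x;q)_\infty=\prod_{k\ge 0}(1-xq^k)$, and write $(x_1,\dots,x_m;q)_n=\prod_i (x_i;q)_n$ for $n\in\{0,1,2,\dots\}\cup\{\infty\}$. Let $${}_r\phi_s\left[\begin{matrix}a_1,\dots,a_r\\ b_1,\dots,b_s\end{matrix};q,z\right]=\sum_{n\ge 0}\frac{(a_1,\dots,a_r;q)_n}{(q,b_1,\dots,b_s;q)_n}\left[(-1)^nq^{n(n-1)/2}\right]^{1+s-r}z^n .$$ Let $a,b,c,d,e,f$ be nonzero complex numbers and let $\sqrt a$ be either square root of $a$. Assume that no denominator in the formula below vanishes, that is, $(x;q)_n\neq 0$ for every lower parameter $x$ of the two series and every $n\ge 0$, and $(aq/d,aq/e,aq/f,aq/(def);q)_\infty\ne 0$. Assume further that the ${}_8\phi_7$ series satisfies the usual convergence condition: either $\left|\frac{a^2q^2}{bcdef}\right|<1$, or the ${}_8\phi_7$ series terminates. Finally assume that the ${}_4\phi_3$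 series terminates. (A series with upper parameters $a_1,\dots,a_r$ terminates if $(a_1,\dots,a_r;q)_n=0$ for some $n$; for $q\ne0$ this means that some $a_i$ is of the form $q^{-m}$ with an integer $m\ge 0$.) Then the ${}_8\phi_7$ series converges absolutely and $${}_8\phi_7\left[\begin{matrix}a,\ q\sqrt a,\ -q\sqrt a,\ b,\ c,\ d,\ e,\ f\\ \sqrt a,\ -\sqrt a,\ aq/b,\ aq/c,\ aq/d,\ aq/e,\ aq/f\end{matrix};q,\frac{a^2q^2}{bcdef}\right] =\frac{(aq,\ aq/(ef),\ aq/(df),\ aq/(de);q)_\infty}{(aq/d,\ aq/e,\ aq/f,\ aq/(def);q)_\infty}\;{}_4\phi_3\left[\begin{matrix}aq/(bc),\ d,\ e,\ f\\ def/a,\ aq/b,\ aq/c\end{matrix};q,q\right].$$ -/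

import Mathlib

namespace BasicHyp

/-- The `q`-shifted factorial `(a; q)_n = (1 - a) (1 - a q) ⋯ (1 - a q ^ (n - 1))`. -/
def qPoch (q a : ℂ) (n : ℕ) : ℂ := ∏ k ∈ Finset.range n, (1 - a * q ^ k)

/-- The infinite product `(a; q)_∞ = ∏_{k ≥ 0} (1 - a q ^ k)`, convergent for `|q| < 1`. -/
noncomputable def qPochInf (q a : ℂ) : ℂ := ∏' k : ℕ, (1 - a * q ^ k)

/-- `(a₁, …, a_m; q)_n = (a₁; q)_n ⋯ (a_m; q)_n`. -/
def qPochs (q : ℂ) (as : List ℂ) (n : ℕ) : ℂ := (as.map fun a => qPoch q a n).prod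

/-- `(a₁, …, a_m; q)_∞ = (a₁; q)_∞ ⋯ (a_m; q)_∞`. -/
noncomputable def qPochsInf (q : ℂ) (as : List ℂ) : ℂ := (as.map fun a => qPochInf q a).prod

/-- The `n`-th term of the series `_rφ_s` with upper parameters `as` (so `r = as.length`),
lower parameters `bs` (so `s = bs.length`), base `q` and argument `z`. -/
noncomputable def phiTerm (as bs : List ℂ) (q z : ℂ) (n : ℕ) : ℂ :=
  qPochs q as n / qPochs q (q :: bs) n
    * ((-1) ^ n * q ^ (n * (n - 1) / 2)) ^ (1 + (bs.length : ℤ) - (as.length : ℤ)) * z ^ n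

/-- The basic hypergeometric series `_rφ_s [as; bs; q, z]`. -/
noncomputable def phi (as bs : List ℂ) (q z : ℂ) : ℂ := ∑' n : ℕ, phiTerm as bs q z n

/-- No denominator factor of a series with lower parameters `bs` vanishes. -/
def DenomNeZero (q : ℂ) (bs : List ℂ) : Prop := ∀ n : ℕ, qPochs q (q :: bs) n ≠ 0

/-- A series with upper parameters `as` terminates: `(a₁, …, a_r; q)_n = 0` for some `n` (hence
for all later `n`). For `q ≠ 0` this says that some `a_i` is `q ^ (-m)` with `m` natural. -/
def Terminates (q : ℂ) (as : List ℂ) : Prop := ∃ n : ℕ, qPochs q as n = 0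

end BasicHyp

/-!
Why the transformation holds. By the `q`-Saalschütz summation (`saalschutz`), the factor
`(b, c; q)_n / (aq/b, aq/c; q)_n * (aq/(bc)) ^ n` of the `n`-th term of the `₈φ₇` series is a
terminating balanced series `₃φ₂ [q ^ (-n), a q ^ n, aq/(bc); aq/b, aq/c; q, q]`. This turns the
`₈φ₇` series into a double series (`doubleTerm`). Its `j`-th column is a multiple of the
very-well-poised `₆φ₅` series with parameters `a q ^ (2j); d q ^ j, e q ^ j, f q ^ j`
(`doubleTerm_add`), and the value of that series as an infinite product makes the column a term of
the `₄φ₃` series times the product in the theorem (`hasSum_doubleTerm`). Since the `₄φ₃` series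
terminates, only finitely many columns are nonzero, so the interchange of summation and the
absolute convergence follow from the convergence of each single column (`hasSum_eight`).

Both summations used rest on a first-order recurrence in the parameters, proved by telescoping. For
the `₆φ₅` series (`SixAdmissible.hasSum`) the recurrence relates `a` to `aq`; it is iterated, and
dominated convergence shows that the series with `a q ^ N` tends to its initial term.

The columns converge if `d`, `e` or `f` makes the series terminate, and, when `aq/(bc) = q ^ (-m)`,
if the argument of the `₈φ₇` series lies in the unit disc. What is left is the case in which the
`₈φ₇` series terminates through none of `d, e, f`. It cannot terminate through `q√a`, `-q√a`,
`b` or `c`, since a denominator would vanish, so `a = q ^ (-k)`. Then the product `(aq; q)_∞` on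
the right vanishes, and so does the left side, because its terms change sign under reversal of the
order of summation (`eight_antisymm`, `hasSum_eight_zero`).
-/

namespace BasicHyp

open Filter Topology

/-! ### Shifted factorials and their infinite products -/

lemma qPoch_zero (q x : ℂ) : qPoch q x 0 = 1 := by simp [qPoch]

lemma qPoch_succ (q x : ℂ) (n : ℕ) : qPoch q x (n + 1) = qPoch q x n * (1 - x * q ^ n) := by
  simp [qPoch, Finset.prod_range_succ]

lemma qPoch_succ' (q x : ℂ) (n : ℕ) : qPoch q x (n + 1) = (1 - x) * qPoch q (x * q) n := by
  simp only [qPoch, Finset.prod_range_succ', pow_zero, mul_one]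
  rw [mul_comm]
  congr 1
  exact Finset.prod_congr rfl fun k _ => by ring

lemma qPoch_add (q x : ℂ) (m n : ℕ) :
    qPoch q x (m + n) = qPoch q x m * qPoch q (x * q ^ m) n := by
  simp only [qPoch, Finset.prod_range_add]
  congr 1
  exact Finset.prod_congr rfl fun k _ => by ring

lemma qPoch_eq_zero_of_le {q x : ℂ} {m n : ℕ} (h : qPoch q x m = 0) (hmn : m ≤ n) :
    qPoch q x n = 0 := by
  obtain ⟨k, rfl⟩ := Nat.exists_eq_add_of_le hmn
  rw [qPoch_add, h, zero_mul]

/-- Reversal of the factors of a `q`-shifted factorial. -/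
lemma qPoch_reflect {q x : ℂ} (hq : q ≠ 0) (hx : x ≠ 0) (n : ℕ) :
    qPoch q (x⁻¹ * q * q⁻¹ ^ n) n = (-x⁻¹) ^ n * q⁻¹ ^ (n * (n - 1) / 2) * qPoch q x n := by
  have h1 : qPoch q (x⁻¹ * q * q⁻¹ ^ n) n
      = ∏ i ∈ Finset.range n, ((-x⁻¹) * q⁻¹ ^ i * (1 - x * q ^ i)) := by
    rw [qPoch, ← Finset.prod_range_reflect]
    refine Finset.prod_congr rfl fun i hi => ?_
    obtain ⟨k, rfl⟩ := Nat.exists_eq_add_of_lt (Finset.mem_range.1 hi)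
    rw [show i + k + 1 - 1 - i = k by omega]
    simp only [inv_pow]
    field_simp
    ring
  rw [h1, Finset.prod_mul_distrib, Finset.prod_mul_distrib, Finset.prod_const, Finset.card_range,
    Finset.prod_pow_eq_pow_sum, Finset.sum_range_id, qPoch]

lemma summable_norm_mul_pow {q : ℂ} (hq : ‖q‖ < 1) (x : ℂ) :
    Summable fun k : ℕ => ‖-(x * q ^ k)‖ := by
  simpa [norm_mul, norm_pow] using (summable_geometric_of_lt_one (norm_nonneg q) hq).mul_left ‖x‖

lemma tendsto_qPoch {q : ℂ} (hq : ‖q‖ < 1) (x : ℂ) :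
    Tendsto (qPoch q x) atTop (𝓝 (qPochInf q x)) := by
  have := (multipliable_one_add_of_summable (summable_norm_mul_pow hq x)).tendsto_prod_tprod_nat
  simp only [← sub_eq_add_neg] at this
  exact this

lemma qPochInf_ne_zero {q x : ℂ} (hq : ‖q‖ < 1) (h : ∀ n, qPoch q x n ≠ 0) :
    qPochInf q x ≠ 0 := by
  have := tprod_one_add_ne_zero_of_summable (f := fun k : ℕ => -(x * q ^ k)) (fun k => ?_)
    (summable_norm_mul_pow hq x)
  · simpa only [← sub_eq_add_neg, qPochInf] using this
  · have := h (k + 1)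
    rw [qPoch_succ] at this
    simpa only [← sub_eq_add_neg] using right_ne_zero_of_mul this

lemma qPochInf_eq_mul {q : ℂ} (hq : ‖q‖ < 1) (x : ℂ) (m : ℕ) :
    qPochInf q x = qPoch q x m * qPochInf q (x * q ^ m) := by
  refine tendsto_nhds_unique ((tendsto_qPoch hq x).comp (tendsto_add_atTop_nat m)) ?_
  refine ((tendsto_qPoch hq (x * q ^ m)).const_mul (qPoch q x m)).congr fun n => ?_
  rw [Function.comp, add_comm n m, qPoch_add]

lemma qPoch_ne_zero_of_qPochInf {q x : ℂ} (hq : ‖q‖ < 1) (h : qPochInf q x ≠ 0) (n : ℕ) :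
    qPoch q x n ≠ 0 := by
  rw [qPochInf_eq_mul hq x n] at h
  exact left_ne_zero_of_mul h

lemma qPoch_shift_ne_zero {q x : ℂ} (h : ∀ n, qPoch q x n ≠ 0) (m n : ℕ) :
    qPoch q (x * q ^ m) n ≠ 0 := by
  have := h (m + n)
  rw [qPoch_add] at this
  exact right_ne_zero_of_mul this

lemma qPoch_self_ne_zero {q : ℂ} (hq : ‖q‖ < 1) (n : ℕ) : qPoch q q n ≠ 0 := by
  rw [qPoch, Finset.prod_ne_zero_iff]
  intro k _ h
  have h1 : ‖q ^ (k + 1)‖ < 1 := by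
    rw [norm_pow]; exact pow_lt_one₀ (norm_nonneg q) hq (Nat.succ_ne_zero k)
  rw [pow_succ', ← sub_eq_zero.1 h, norm_one] at h1
  exact lt_irrefl _ h1

lemma exists_norm_inv_qPoch_le {q x : ℂ} (hq : ‖q‖ < 1) (h : ∀ n, qPoch q x n ≠ 0) :
    ∃ M, 0 < M ∧ ∀ n, ‖(qPoch q x n)⁻¹‖ ≤ M := by
  obtain ⟨M, hM⟩ := ((tendsto_qPoch hq x).inv₀ (qPochInf_ne_zero hq h)).norm.bddAbove_range
  exact ⟨max M 1, by positivity, fun n => (hM ⟨n, rfl⟩).trans (le_max_left _ _)⟩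

/-! ### The `q`-Saalschütz summation -/

/-- The `j`-th term of the series `₃φ₂ [E, A, B; C, D; q, q]`. -/
noncomputable def saalTerm (q E A B C D : ℂ) (j : ℕ) : ℂ :=
  qPoch q E j * qPoch q A j * qPoch q B j / (qPoch q q j * qPoch q C j * qPoch q D j) * q ^ j

/-- The polynomial identity behind `saalTerm_telescope`, with `Q` standing for `q ^ j`. -/
lemma saal_core {q E A B C D Q : ℂ} (hq : q ≠ 0) (hA : A ≠ 0) (hB : B ≠ 0)
    (hC : C ≠ 0) (hbal : C * D = A * B * E * q) :
    (1 - E) * (1 - C * Q) * Q * (q * E - D)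
      + (1 - C / A) * (1 - C / B) * D * (1 - E * Q) * Q =
    q * E * (1 - E * Q) * (1 - A * Q) * (1 - B * Q)
      - E * (1 - Q) * (1 - C * Q) * (q - D * Q) := by
  have : D = A * B * E * q / C := by field_simp; linear_combination hbal
  subst this
  field_simp
  ring

/-- The sequence whose differences occur in `saalTerm_telescope`: its value at `j` is a rational
multiple of the `j`-th term, and it starts at `0`. -/
noncomputable def saalAntidiff (q E A B C D : ℂ) : ℕ → ℂ
  | 0 => 0
  | j + 1 => q * E * (qPoch q (E * q) j * qPoch q A (j + 1) * qPoch q B (j + 1)) /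
      (qPoch q q j * qPoch q C (j + 1) * qPoch q D j)

/-- Passing from `(E, C)` to `(Eq, Cq)` multiplies a terminating balanced series by an explicit
factor, since the difference of the two terms telescopes. For `E = q ^ (-n)` this lowers `n`
by one. -/
lemma saalTerm_telescope {q E A B C D : ℂ} (hq : q ≠ 0) (hA : A ≠ 0) (hB : B ≠ 0)
    (hC : C ≠ 0) (hbal : C * D = A * B * E * q) (hqn : ∀ k, qPoch q q k ≠ 0)
    (hCn : ∀ k, qPoch q C k ≠ 0) (hDn : ∀ k, qPoch q D k ≠ 0) (j : ℕ) :
    saalTerm q E A B C D j * (q * E - D)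
      + (1 - C / A) * (1 - C / B) * D / (1 - C) * saalTerm q (E * q) A B (C * q) D j
    = saalAntidiff q E A B C D (j + 1) - saalAntidiff q E A B C D j := by
  have core0 : (1 - C) * (q * E - D) + (1 - C / A) * (1 - C / B) * D
      = q * E * (1 - A) * (1 - B) := by
    have : D = A * B * E * q / C := by field_simp; linear_combination hbal
    subst this
    field_simp
    ring
  have core := fun Q => saal_core (Q := Q) hq hA hB hC hbal
  generalize (1 - C / A) * (1 - C / B) = r at core core0 ⊢
  have hC1 : 1 - C ≠ 0 := by simpa [qPoch] using hCn 1
  cases j with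
  | zero =>
    simp only [saalTerm, saalAntidiff, qPoch_zero, qPoch_succ, pow_zero]
    field_simp
    linear_combination core0
  | succ j =>
    have h1 := hqn (j + 1)
    have h2 := hCn (j + 2)
    have h3 := hDn (j + 1)
    have h4 : qPoch q (C * q) (j + 1) = qPoch q C (j + 1) * (1 - C * q ^ (j + 1)) / (1 - C) := by
      rw [eq_div_iff hC1, ← qPoch_succ, qPoch_succ' q C (j + 1), mul_comm]
    rw [qPoch_succ] at h1 h2 h3
    simp only [saalTerm, saalAntidiff, h4, qPoch_succ' q E j, qPoch_succ q A (j + 1),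
      qPoch_succ q B (j + 1), qPoch_succ q C (j + 1), qPoch_succ q q j, qPoch_succ q D j,
      qPoch_succ q (E * q) j]
    have h1l := left_ne_zero_of_mul h1
    have h1r := right_ne_zero_of_mul h1
    have h2l := left_ne_zero_of_mul h2
    have h2r := right_ne_zero_of_mul h2
    have h3l := left_ne_zero_of_mul h3
    have h3r := right_ne_zero_of_mul h3
    have := core (q ^ (j + 1))
    generalize qPoch q A (j + 1) = pA
    generalize qPoch q B (j + 1) = pB
    generalize qPoch q (E * q) j = pE
    generalize qPoch q C (j + 1) = pC at *
    generalize qPoch q D j = pD at *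
    generalize qPoch q q j = pq at *
    have e1 : q * q ^ j = q ^ (j + 1) := by ring
    have e2 : E * q * q ^ j = E * q ^ (j + 1) := by ring
    have e3 : 1 - D * q ^ j = (q - D * q ^ (j + 1)) / q := by field_simp; ring
    rw [e3] at h3r
    rw [e1] at h1r
    rw [e1, e2, e3]
    generalize q ^ (j + 1) = Q at *
    have h5 : q - D * Q ≠ 0 := fun h => h3r (by rw [h, zero_div])
    clear core core0 h4
    generalize 1 - Q = y1 at *
    generalize 1 - C * Q = y2 at *
    generalize q - D * Q = y3 at *
    rw [← sub_eq_zero] at this ⊢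
    refine Eq.trans ?_ (mul_eq_zero_of_right
      (pE * pA * pB * q / (pq * y1 * (pC * y2) * pD * y3)) this)
    field_simp

/-- The `q`-Saalschütz summation, in the special case that expands
`(b, c; q)_n / (aq/b, aq/c; q)_n`. The induction on `n` replaces `(a, b, c)` by `(aq, b, cq)`,
which leaves three of the five parameters of the series unchanged. -/
theorem saalschutz {q : ℂ} (hq : q ≠ 0) (hqn : ∀ k, qPoch q q k ≠ 0) (n : ℕ) :
    ∀ a b c : ℂ, a ≠ 0 → b ≠ 0 → c ≠ 0 → (∀ k, qPoch q (a * q / b) k ≠ 0) →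
      (∀ k, qPoch q (a * q / c) k ≠ 0) →
      ∑ j ∈ Finset.range (n + 1),
        saalTerm q (q⁻¹ ^ n) (a * q ^ n) (a * q / (b * c)) (a * q / b) (a * q / c) j =
      qPoch q b n * qPoch q c n / (qPoch q (a * q / b) n * qPoch q (a * q / c) n) *
        (a * q / (b * c)) ^ n := by
  induction n with
  | zero => simp [saalTerm, qPoch_zero]
  | succ n ih =>
    intro a b c ha hb hc hbn hcn
    have e1 : q⁻¹ ^ (n + 1) * q = q⁻¹ ^ n := by rw [pow_succ, inv_mul_cancel_right₀ hq]
    have key : ∀ j, _ := saalTerm_telescope (q := q) (E := q⁻¹ ^ (n + 1)) (A := a * q ^ (n + 1))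
      (B := a * q / (b * c)) (C := a * q / b) (D := a * q / c) hq (by positivity) (by positivity)
      (by positivity) (by simp only [inv_pow]; field_simp) hqn hbn hcn
    have hIH := ih (a * q) b (c * q) (by positivity) hb (by positivity)
      (fun k => by
        have := qPoch_shift_ne_zero hbn 1 k
        rwa [pow_one, div_mul_eq_mul_div] at this)
      (fun k => by
        have := hcn k
        rwa [← mul_div_mul_right (a * q) c hq] at this)
    rw [mul_div_mul_right _ c hq, ← mul_assoc b c q, mul_div_mul_right _ (b * c) hq,
      ← div_mul_eq_mul_div (a * q) b q, show a * q * q ^ n = a * q ^ (n + 1) by ring] at hIH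
    have hsum := Finset.sum_congr (rfl : Finset.range (n + 2) = _) fun j _ => key j
    -- The upper boundary term of the telescoping sum and the last term of the shorter series
    -- vanish, because `(q ^ (-n); q)_{n+1} = 0`.
    have hvan : qPoch q (q⁻¹ ^ n) (n + 1) = 0 := by
      rw [qPoch_succ, ← mul_pow, inv_mul_cancel₀ hq, one_pow, sub_self, mul_zero]
    rw [Finset.sum_range_sub, Finset.sum_add_distrib, ← Finset.sum_mul, ← Finset.mul_sum,
      Finset.sum_range_succ (fun j => saalTerm q _ _ _ (_ * q) _ j)] at hsum
    simp only [e1] at hsum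
    rw [hIH] at hsum
    simp only [saalTerm, saalAntidiff, e1, hvan] at hsum
    simp only [mul_zero, zero_mul, zero_div, sub_zero, add_zero] at hsum
    have hn := hcn (n + 1)
    have hb1 := hbn (n + 1)
    rw [qPoch_succ] at hn
    rw [qPoch_succ'] at hb1
    have hnr := right_ne_zero_of_mul hn
    have hnl := left_ne_zero_of_mul hn
    have hbr := right_ne_zero_of_mul hb1
    have hbl := left_ne_zero_of_mul hb1
    have e2 : q * q⁻¹ ^ (n + 1) - a * q / c = q⁻¹ ^ n * (1 - a * q / c * q ^ n) := by
      simp only [inv_pow]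
      field_simp
      ring
    have e3 : 1 - a * q / b / (a * q ^ (n + 1)) = -(q⁻¹ ^ n * b⁻¹ * (1 - b * q ^ n)) := by
      simp only [inv_pow]
      field_simp
      ring
    have e4 : 1 - a * q / b / (a * q / (b * c)) = 1 - c := by field_simp
    have hqi : q⁻¹ ^ n ≠ 0 := pow_ne_zero _ (inv_ne_zero hq)
    rw [e2, e3, e4] at hsum
    simp only [saalTerm]
    refine mul_right_cancel₀ (mul_ne_zero hqi hnr) ?_
    rw [eq_neg_of_add_eq_zero_left hsum, qPoch_succ q b, qPoch_succ' q c, qPoch_succ' q (a * q / b),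
      qPoch_succ q (a * q / c), pow_succ (a * q / (b * c)) n]
    generalize qPoch q (a * q / b * q) n = pb at *
    generalize qPoch q (a * q / c) n = pc at *
    generalize 1 - a * q / c * q ^ n = y1 at *
    generalize 1 - a * q / b = y2 at *
    generalize (a * q / (b * c)) ^ n = y3
    generalize q⁻¹ ^ n = y4 at *
    field_simp

/-! ### The very-well-poised `₆φ₅` summation -/

/-- The very-well-poised factor `(a, q√a, -q√a; q)_n / (√a, -√a; q)_n`, written as
`(1 - a q ^ (2n)) (aq; q)_{n-1}` for `n ≥ 1` and `1` for `n = 0`. In this form it is a polynomial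
in `a`, so that no condition `a q ^ k ≠ 1` is needed when `a` is shifted. -/
def vwp (q a : ℂ) : ℕ → ℂ
  | 0 => 1
  | n + 1 => (1 - a * q ^ (2 * (n + 1))) * qPoch q (a * q) n

/-- The `n`-th term of the very-well-poised series
`₆φ₅ [a, q√a, -q√a, b, c, d; √a, -√a, aq/b, aq/c, aq/d; q, aq/(bcd)]`. -/
noncomputable def sixTerm (q a b c d : ℂ) (n : ℕ) : ℂ :=
  vwp q a n / qPoch q q n * (qPoch q b n * qPoch q c n * qPoch q d n /
    (qPoch q (a * q / b) n * qPoch q (a * q / c) n * qPoch q (a * q / d) n)) *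
    (a * q / (b * c * d)) ^ n

/-- The sequence whose differences occur in `sixTerm_telescope`. -/
noncomputable def sixAntidiff (q a b c d : ℂ) : ℕ → ℂ
  | 0 => 0
  | n + 1 => -((1 - a * (a * q / (b * c * d)) * q ^ (n + 1)) / (1 - a * q / (b * c * d)) *
      (qPoch q (a * q) n * (qPoch q b (n + 1) * qPoch q c (n + 1) * qPoch q d (n + 1)) /
      (qPoch q q n *
      (qPoch q (a * q / b) (n + 1) * qPoch q (a * q / c) (n + 1) * qPoch q (a * q / d) (n + 1))) *
      (a * q / (b * c * d)) ^ (n + 1)))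

/-- The ratio of the sums of the `₆φ₅` series with parameters `a; b, c, d` and `aq; b, c, d`. -/
noncomputable def sixRatio (q a b c d : ℂ) : ℂ :=
  (1 - a * q) * ((1 - a * q / (b * c)) * (1 - a * q / (b * d)) * (1 - a * q / (c * d))) /
    ((1 - a * q / b) * (1 - a * q / c) * (1 - a * q / d) * (1 - a * q / (b * c * d)))

/-- The polynomial identity behind `sixTerm_telescope`, with `Q` standing for `q ^ n`. -/
lemma six_core {q a b c d z Q : ℂ} (hb : b ≠ 0) (hc : c ≠ 0) (hd : d ≠ 0)
    (hz : z = a * q / (b * c * d)) :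
    (1 - z) * ((1 - a * Q ^ 2) * ((1 - a * q / b * Q) * (1 - a * q / c * Q) * (1 - a * q / d * Q)))
     - (1 - a * q / (b * c)) * (1 - a * q / (b * d)) * (1 - a * q / (c * d)) *
        ((1 - a * q * Q ^ 2) * (1 - a * Q) * Q)
    = -((1 - a * Q) * ((1 - b * Q) * (1 - c * Q) * (1 - d * Q)) * z * (1 - a * z * (q * Q)))
      + (1 - Q) * ((1 - a * q / b * Q) * (1 - a * q / c * Q) * (1 - a * q / d * Q))
        * (1 - a * z * Q) := by
  subst hz
  field_simp
  ring

/-- The case `Q = 1` of `six_core`, divided by `1 - a`. -/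
lemma six_core_zero {q a b c d z : ℂ} (hb : b ≠ 0) (hc : c ≠ 0) (hd : d ≠ 0)
    (hz : z = a * q / (b * c * d)) :
    (1 - z) * ((1 - a * q / b) * (1 - a * q / c) * (1 - a * q / d))
     - (1 - a * q / (b * c)) * (1 - a * q / (b * d)) * (1 - a * q / (c * d)) * (1 - a * q)
    = -((1 - b) * (1 - c) * (1 - d) * z * (1 - a * z * q)) := by
  subst hz
  field_simp
  ring

lemma sixTerm_telescope {q a b c d : ℂ} (hb : b ≠ 0) (hc : c ≠ 0) (hd : d ≠ 0)
    (hqn : ∀ k, qPoch q q k ≠ 0)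
    (hbn : ∀ k, qPoch q (a * q / b) k ≠ 0) (hcn : ∀ k, qPoch q (a * q / c) k ≠ 0)
    (hdn : ∀ k, qPoch q (a * q / d) k ≠ 0) (hz : 1 - a * q / (b * c * d) ≠ 0) (n : ℕ) :
    sixTerm q a b c d n - sixRatio q a b c d * sixTerm q (a * q) b c d n
      = sixAntidiff q a b c d (n + 1) - sixAntidiff q a b c d n := by
  have core0 := six_core_zero (q := q) (a := a) hb hc hd rfl
  have core := fun Q => six_core (q := q) (a := a) (Q := Q) hb hc hd rfl
  have step : ∀ x, (∀ k, qPoch q (a * q / x) k ≠ 0) → ∀ k, 1 - a * q / x ≠ 0 ∧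
      1 - a * q / x * q ^ k ≠ 0 ∧
      qPoch q (a * q * q / x) k
        = qPoch q (a * q / x) k * (1 - a * q / x * q ^ k) / (1 - a * q / x) := by
    intro x h k
    have h1 : 1 - a * q / x ≠ 0 := by simpa [qPoch] using h 1
    have h2 := h (k + 1)
    rw [qPoch_succ] at h2
    refine ⟨h1, right_ne_zero_of_mul h2, ?_⟩
    rw [eq_div_iff h1, ← qPoch_succ, qPoch_succ', mul_comm, div_mul_eq_mul_div]
  have ez : a * q * q / (b * c * d) = a * q / (b * c * d) * q := by ring
  cases n with
  | zero =>
    obtain ⟨hb1, -, -⟩ := step b hbn 0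
    obtain ⟨hc1, -, -⟩ := step c hcn 0
    obtain ⟨hd1, -, -⟩ := step d hdn 0
    simp only [sixTerm, sixAntidiff, sixRatio, vwp, qPoch_zero, qPoch_succ, pow_zero, zero_add,
      pow_one, mul_one, one_mul, div_one, sub_zero]
    generalize a * q / (b * c * d) = z at *
    generalize 1 - a * q / b = y1 at *
    generalize 1 - a * q / c = y2 at *
    generalize 1 - a * q / d = y3 at *
    generalize (1 - a * q / (b * c)) * (1 - a * q / (b * d)) * (1 - a * q / (c * d)) = r at *
    field_simp
    linear_combination core0
  | succ n =>
    obtain ⟨hb1, hb2, hb3⟩ := step b hbn (n + 1)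
    obtain ⟨hc1, hc2, hc3⟩ := step c hcn (n + 1)
    obtain ⟨hd1, hd2, hd3⟩ := step d hdn (n + 1)
    have h1 := hqn (n + 1)
    have hb4 := hbn (n + 1)
    have hc4 := hcn (n + 1)
    have hd4 := hdn (n + 1)
    have ha3 : (1 - a * q) * qPoch q (a * q * q) n
        = qPoch q (a * q) n * (1 - a * q * q ^ n) := by rw [← qPoch_succ', qPoch_succ]
    have key := core (q ^ (n + 1))
    have eq1 : qPoch q q (n + 1) = qPoch q q n * (1 - q ^ (n + 1)) := by rw [qPoch_succ, pow_succ']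
    have eQ2 : q ^ (2 * (n + 1)) = (q ^ (n + 1)) ^ 2 := by ring
    have eQ3 : a * q * q ^ n = a * q ^ (n + 1) := by ring
    have eQ4 : q ^ (n + 1 + 1) = q * q ^ (n + 1) := by ring
    rw [eq1] at h1
    have h1l := left_ne_zero_of_mul h1
    have h1r := right_ne_zero_of_mul h1
    simp only [sixTerm, sixAntidiff, sixRatio, vwp, ez, hb3, hc3, hd3, mul_pow, eQ2, eQ4,
      qPoch_succ q b (n + 1), qPoch_succ q c (n + 1), qPoch_succ q d (n + 1),
      qPoch_succ q (a * q / b) (n + 1), qPoch_succ q (a * q / c) (n + 1),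
      qPoch_succ q (a * q / d) (n + 1), qPoch_succ q (a * q) n, eq1]
    rw [eQ3] at ha3 ⊢
    rw [pow_succ (a * q / (b * c * d)) (n + 1)]
    clear core core0 step hbn hcn hdn hqn h1 eq1 eQ2 eQ3 eQ4 hb3 hc3 hd3 ez
    generalize q ^ (n + 1) = Q at *
    generalize (a * q / (b * c * d)) ^ (n + 1) = zn
    generalize a * q / (b * c * d) = z at *
    generalize 1 - a * q / b * Q = w1 at *
    generalize 1 - a * q / c * Q = w2 at *
    generalize 1 - a * q / d * Q = w3 at *
    generalize 1 - a * q / b = y1 at *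
    generalize 1 - a * q / c = y2 at *
    generalize 1 - a * q / d = y3 at *
    generalize (1 - a * q / (b * c)) * (1 - a * q / (b * d)) * (1 - a * q / (c * d)) = r at *
    generalize qPoch q b (n + 1) = pb
    generalize qPoch q c (n + 1) = pc
    generalize qPoch q d (n + 1) = pd
    generalize qPoch q (a * q / b) (n + 1) = pb' at *
    generalize qPoch q (a * q / c) (n + 1) = pc' at *
    generalize qPoch q (a * q / d) (n + 1) = pd' at *
    generalize qPoch q q n = pq at *
    generalize qPoch q (a * q * q) n = pa' at *
    generalize qPoch q (a * q) n = pa at *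
    generalize 1 - Q = y at *
    generalize 1 - z = t at *
    have e5 : (1 - a * q) * r / (y1 * y2 * y3 * t) *
        ((1 - a * q * Q ^ 2) * pa' / (pq * y) *
          (pb * pc * pd / (pb' * w1 / y1 * (pc' * w2 / y2) * (pd' * w3 / y3))) * (zn * Q))
        = r / t * ((1 - a * q * Q ^ 2) * (pa * (1 - a * Q)) / (pq * y) *
          (pb * pc * pd / (pb' * w1 * (pc' * w2) * (pd' * w3))) * (zn * Q)) := by
      rw [← ha3]
      field_simp
    rw [e5]
    rw [← sub_eq_zero] at key ⊢
    refine Eq.trans ?_ (mul_eq_zero_of_right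
      (pa * pb * pc * pd * zn / (pq * y * (pb' * w1) * (pc' * w2) * (pd' * w3) * t)) key)
    field_simp
    ring

lemma exists_norm_qPoch_le_uniform {q : ℂ} (hq : ‖q‖ < 1) (x : ℂ) :
    ∃ M, 0 < M ∧ ∀ y n, ‖y‖ ≤ ‖x‖ → ‖qPoch q y n‖ ≤ M := by
  refine ⟨Real.exp (∑' k, ‖-(x * q ^ k)‖), Real.exp_pos _, fun y n hy => ?_⟩
  have h1 := Finset.norm_prod_one_add_sub_one_le (Finset.range n) fun k => -(y * q ^ k)
  simp only [← sub_eq_add_neg] at h1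
  have h2 : ‖qPoch q y n‖ ≤ Real.exp (∑ k ∈ Finset.range n, ‖-(y * q ^ k)‖) := by
    have := norm_le_norm_add_norm_sub' (qPoch q y n) 1
    rw [norm_one] at this
    unfold qPoch at *
    linarith
  refine h2.trans (Real.exp_le_exp.2 ?_)
  refine (Finset.sum_le_sum fun k _ => ?_).trans
    ((summable_norm_mul_pow hq x).sum_le_tsum _ fun _ _ => norm_nonneg _)
  simp only [norm_neg, norm_mul]
  gcongr

lemma exists_norm_inv_qPoch_shift_le {q x : ℂ} (hq : ‖q‖ < 1) (h : ∀ n, qPoch q x n ≠ 0) :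
    ∃ M, 0 < M ∧ ∀ N n, ‖(qPoch q (x * q ^ N) n)⁻¹‖ ≤ M := by
  obtain ⟨M, hM, hM'⟩ := exists_norm_qPoch_le_uniform hq x
  obtain ⟨K, hK, hK'⟩ := exists_norm_inv_qPoch_le hq h
  refine ⟨M * K, by positivity, fun N n => ?_⟩
  have : (qPoch q (x * q ^ N) n)⁻¹ = qPoch q x N * (qPoch q x (N + n))⁻¹ := by
    rw [qPoch_add, mul_inv, mul_inv_cancel_left₀ (h N)]
  rw [this, norm_mul]
  gcongr
  · exact hM' x N le_rfl
  · exact hK' _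

lemma norm_mul_pow_le {q : ℂ} (hq : ‖q‖ < 1) (x : ℂ) (k : ℕ) : ‖x * q ^ k‖ ≤ ‖x‖ := by
  rw [norm_mul, norm_pow]
  exact mul_le_of_le_one_right (norm_nonneg _) (pow_le_one₀ (norm_nonneg _) hq.le)

lemma exists_norm_vwp_le {q : ℂ} (hq : ‖q‖ < 1) (a : ℂ) :
    ∃ M, 0 < M ∧ ∀ N n, ‖vwp q (a * q ^ N) n‖ ≤ M := by
  obtain ⟨M, hM, hM'⟩ := exists_norm_qPoch_le_uniform hq a
  refine ⟨max 1 ((1 + ‖a‖) * M), by positivity, fun N n => ?_⟩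
  cases n with
  | zero => simp [vwp]
  | succ n =>
    refine le_trans ?_ (le_max_right _ _)
    rw [vwp, norm_mul]
    gcongr
    · refine (norm_sub_le _ _).trans ?_
      rw [norm_one, mul_assoc, ← pow_add]
      gcongr
      exact norm_mul_pow_le hq a _
    · apply hM'
      rw [mul_assoc, ← pow_succ]
      exact norm_mul_pow_le hq a _

/-- The conditions under which the very-well-poised `₆φ₅` series with parameters `a; b, c, d` is
summed: no denominator vanishes, and the series converges absolutely, be it because its argument
`aq / (bcd)` lies in the unit disc or because `b`, `c` or `d` makes it terminate. -/
structure SixAdmissible (q a b c d : ℂ) : Prop where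
  left : ∀ k, qPoch q (a * q / b) k ≠ 0
  mid : ∀ k, qPoch q (a * q / c) k ≠ 0
  right : ∀ k, qPoch q (a * q / d) k ≠ 0
  arg : ∀ k, qPoch q (a * q / (b * c * d)) k ≠ 0
  summable : Summable fun n =>
    ‖qPoch q b n * qPoch q c n * qPoch q d n * (a * q / (b * c * d)) ^ n‖

lemma SixAdmissible.shift {q a b c d : ℂ} (hq : ‖q‖ < 1) (h : SixAdmissible q a b c d) (N : ℕ) :
    SixAdmissible q (a * q ^ N) b c d := by
  have e : ∀ x, a * q ^ N * q / x = a * q / x * q ^ N := fun x => by ring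
  refine ⟨fun k => ?_, fun k => ?_, fun k => ?_, fun k => ?_, ?_⟩
  · rw [e]; exact qPoch_shift_ne_zero h.left N k
  · rw [e]; exact qPoch_shift_ne_zero h.mid N k
  · rw [e]; exact qPoch_shift_ne_zero h.right N k
  · rw [e]; exact qPoch_shift_ne_zero h.arg N k
  · refine h.summable.of_nonneg_of_le (fun _ => norm_nonneg _) fun n => ?_
    rw [e, norm_mul, norm_pow, norm_mul (_ * _) (_ ^ n), norm_pow]
    gcongr
    exact norm_mul_pow_le hq _ _

/-- A bound that serves both as the summable majorant of the series shifted by `N` and, through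
its last factor, to show that all terms but the initial one tend to `0` as `N → ∞`. -/
lemma SixAdmissible.exists_norm_sixTerm_le {q a b c d : ℂ} (hq : ‖q‖ < 1)
    (h : SixAdmissible q a b c d) :
    ∃ M, 0 < M ∧ ∀ N n, ‖sixTerm q (a * q ^ N) b c d n‖ ≤
      M * ‖qPoch q b n * qPoch q c n * qPoch q d n * (a * q / (b * c * d)) ^ n‖
        * (‖q‖ ^ N) ^ n := by
  obtain ⟨M1, h1, h1'⟩ := exists_norm_vwp_le hq a
  obtain ⟨M2, h2, h2'⟩ := exists_norm_inv_qPoch_le hq (qPoch_self_ne_zero hq)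
  obtain ⟨M3, h3, h3'⟩ := exists_norm_inv_qPoch_shift_le hq h.left
  obtain ⟨M4, h4, h4'⟩ := exists_norm_inv_qPoch_shift_le hq h.mid
  obtain ⟨M5, h5, h5'⟩ := exists_norm_inv_qPoch_shift_le hq h.right
  refine ⟨M1 * M2 * (M3 * M4 * M5), by positivity, fun N n => ?_⟩
  have e : ∀ x, a * q ^ N * q / x = a * q / x * q ^ N := fun x => by ring
  have : sixTerm q (a * q ^ N) b c d n = vwp q (a * q ^ N) n * (qPoch q q n)⁻¹ *
      ((qPoch q (a * q / b * q ^ N) n)⁻¹ * (qPoch q (a * q / c * q ^ N) n)⁻¹ *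
        (qPoch q (a * q / d * q ^ N) n)⁻¹) *
      (qPoch q b n * qPoch q c n * qPoch q d n * (a * q / (b * c * d)) ^ n) * (q ^ N) ^ n := by
    rw [sixTerm, e, e, e, e, mul_pow, div_eq_mul_inv, div_eq_mul_inv (_ * _) (_ * _), mul_inv,
      mul_inv]
    ring
  rw [this, norm_mul, norm_mul _ (_ * _ ^ n), norm_pow (q ^ N), norm_pow q]
  gcongr
  rw [norm_mul, norm_mul, norm_mul (_ * _), norm_mul]
  gcongr
  exacts [h1' N n, h2' n, h3' N n, h4' N n, h5' N n]

lemma SixAdmissible.summable_sixTerm {q a b c d : ℂ} (hq : ‖q‖ < 1)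
    (h : SixAdmissible q a b c d) : Summable (sixTerm q a b c d) := by
  obtain ⟨M, -, hM⟩ := h.exists_norm_sixTerm_le hq
  refine Summable.of_norm_bounded (h.summable.mul_left M) fun n => ?_
  simpa using hM 0 n

lemma SixAdmissible.tendsto_sixAntidiff {q a b c d : ℂ} (hq : ‖q‖ < 1)
    (h : SixAdmissible q a b c d) : Tendsto (sixAntidiff q a b c d) atTop (𝓝 0) := by
  rw [← tendsto_add_atTop_iff_nat 1]
  have hlim : ∀ {x}, (∀ k, qPoch q x k ≠ 0) → ∀ m,
      Tendsto (fun n => (qPoch q x (n + m))⁻¹) atTop (𝓝 (qPochInf q x)⁻¹) := fun hx m =>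
    ((tendsto_qPoch hq _).inv₀ (qPochInf_ne_zero hq hx)).comp (tendsto_add_atTop_nat m)
  have hz : Tendsto (fun n => qPoch q b (n + 1) * qPoch q c (n + 1) * qPoch q d (n + 1)
      * (a * q / (b * c * d)) ^ (n + 1)) atTop (𝓝 0) :=
    (tendsto_zero_iff_norm_tendsto_zero.2 h.summable.tendsto_atTop_zero).comp
      (tendsto_add_atTop_nat 1)
  have hqp : Tendsto (fun n => q ^ (n + 1)) atTop (𝓝 0) :=
    (tendsto_pow_atTop_nhds_zero_of_norm_lt_one hq).comp (tendsto_add_atTop_nat 1)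
  have := (((((((hqp.const_mul (a * (a * q / (b * c * d)))).const_sub 1).div_const
    (1 - a * q / (b * c * d))).mul (tendsto_qPoch hq (a * q))).mul
    (hlim (qPoch_self_ne_zero hq) 0)).mul
    (((hlim h.left 1).mul (hlim h.mid 1)).mul (hlim h.right 1))).mul hz).neg
  rw [mul_zero, neg_zero] at this
  refine this.congr fun n => ?_
  simp only [sixAntidiff, add_zero]
  generalize a * q / (b * c * d) = z
  ring

lemma SixAdmissible.tsum_eq {q a b c d : ℂ} (hq : ‖q‖ < 1) (hb : b ≠ 0) (hc : c ≠ 0) (hd : d ≠ 0)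
    (h : SixAdmissible q a b c d) :
    ∑' n, sixTerm q a b c d n = sixRatio q a b c d * ∑' n, sixTerm q (a * q) b c d n := by
  have h1 := h.summable_sixTerm hq
  have h2 := (h.shift hq 1).summable_sixTerm hq
  rw [pow_one] at h2
  have hz : 1 - a * q / (b * c * d) ≠ 0 := by simpa [qPoch] using h.arg 1
  have h3 := (h1.sub (h2.mul_left (sixRatio q a b c d))).hasSum.tendsto_sum_nat
  simp only [sixTerm_telescope hb hc hd (qPoch_self_ne_zero hq) h.left h.mid h.right hz,
    Finset.sum_range_sub] at h3
  have h4 := tendsto_nhds_unique h3 ((h.tendsto_sixAntidiff hq).sub_const _)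
  simp only [← sixTerm_telescope hb hc hd (qPoch_self_ne_zero hq) h.left h.mid h.right hz] at h4
  rw [h1.tsum_sub (h2.mul_left _), tsum_mul_left] at h4
  simpa [sixAntidiff, sub_eq_zero] using h4

lemma SixAdmissible.tsum_eq_prod {q a b c d : ℂ} (hq : ‖q‖ < 1) (hb : b ≠ 0) (hc : c ≠ 0)
    (hd : d ≠ 0) (h : SixAdmissible q a b c d) (N : ℕ) :
    ∑' n, sixTerm q a b c d n =
      qPoch q (a * q) N * (qPoch q (a * q / (b * c)) N * qPoch q (a * q / (b * d)) N *
        qPoch q (a * q / (c * d)) N) / (qPoch q (a * q / b) N * qPoch q (a * q / c) N *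
        qPoch q (a * q / d) N * qPoch q (a * q / (b * c * d)) N) *
      ∑' n, sixTerm q (a * q ^ N) b c d n := by
  induction N with
  | zero => simp [qPoch_zero]
  | succ N ih =>
    have e : ∀ x, a * q ^ N * q / x = a * q / x * q ^ N := fun x => by ring
    rw [ih, (h.shift hq N).tsum_eq hq hb hc hd, sixRatio, mul_assoc a (q ^ N) q, ← pow_succ,
      ← mul_assoc, div_mul_div_comm]
    simp only [qPoch_succ, ← e]
    congr 2 <;> ring

/-- The sum of the very-well-poised `₆φ₅` series. Shifting `a` to `a q ^ N` makes the series tend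
to its initial term `1`. -/
theorem SixAdmissible.hasSum {q a b c d : ℂ} (hq : ‖q‖ < 1) (hb : b ≠ 0) (hc : c ≠ 0)
    (hd : d ≠ 0) (h : SixAdmissible q a b c d) :
    HasSum (sixTerm q a b c d)
      (qPochInf q (a * q) * (qPochInf q (a * q / (b * c)) * qPochInf q (a * q / (b * d)) *
        qPochInf q (a * q / (c * d))) / (qPochInf q (a * q / b) * qPochInf q (a * q / c) *
        qPochInf q (a * q / d) * qPochInf q (a * q / (b * c * d)))) := by
  have hlim : Tendsto (fun N : ℕ => ∑' n, sixTerm q (a * q ^ N) b c d n) atTop (𝓝 1) := by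
    obtain ⟨M, hM0, hM⟩ := h.exists_norm_sixTerm_le hq
    have h1 : (1 : ℂ) = ∑' n : ℕ, if n = 0 then 1 else 0 := by rw [tsum_ite_eq]
    rw [h1]
    refine tendsto_tsum_of_dominated_convergence (h.summable.mul_left M) (fun n => ?_)
      (Eventually.of_forall fun N n => (hM N n).trans ?_)
    · rcases n with _ | n
      · simp [sixTerm, vwp, qPoch_zero]
      · refine squeeze_zero_norm (fun N => hM N (n + 1)) ?_
        have : Tendsto (fun N => (‖q‖ ^ N) ^ (n + 1)) atTop (𝓝 0) := by
          simpa using (tendsto_pow_atTop_nhds_zero_of_lt_one (norm_nonneg q) hq).pow (n + 1)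
        simpa using this.const_mul _
    · refine mul_le_of_le_one_right (by positivity) (pow_le_one₀ (by positivity) ?_)
      exact pow_le_one₀ (norm_nonneg _) hq.le
  have hprod := ((((tendsto_qPoch hq (a * q)).mul (((tendsto_qPoch hq (a * q / (b * c))).mul
    (tendsto_qPoch hq (a * q / (b * d)))).mul (tendsto_qPoch hq (a * q / (c * d))))).div
    ((((tendsto_qPoch hq (a * q / b)).mul (tendsto_qPoch hq (a * q / c))).mul
    (tendsto_qPoch hq (a * q / d))).mul (tendsto_qPoch hq (a * q / (b * c * d))))
    (mul_ne_zero (mul_ne_zero (mul_ne_zero (qPochInf_ne_zero hq h.left)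
      (qPochInf_ne_zero hq h.mid)) (qPochInf_ne_zero hq h.right))
      (qPochInf_ne_zero hq h.arg))).mul hlim)
  rw [mul_one] at hprod
  have := tendsto_nhds_unique (hprod.congr fun N => (h.tsum_eq_prod hq hb hc hd N).symm)
    tendsto_const_nhds
  rw [this]
  exact (h.summable_sixTerm hq).hasSum

/-! ### The double series and its columns -/

/-- The factor `(a q ^ n; q)_j` of the balanced series, with `n = j + k`, extends the
very-well-poised factor. -/
lemma vwp_mul_qPoch (q a : ℂ) (j k : ℕ) :
    vwp q a (j + k) * qPoch q (a * q ^ (j + k)) j =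
      qPoch q (a * q) (2 * j) * vwp q (a * q ^ (2 * j)) k := by
  have key : ∀ n, (1 - a * q ^ (2 * (n + 1))) * (qPoch q (a * q) n * qPoch q (a * q ^ (n + 1)) j)
      = (1 - a * q ^ (2 * (n + 1))) * qPoch q (a * q) (n + j) := fun n => by
    rw [qPoch_add, mul_assoc a q, ← pow_succ']
  cases k with
  | zero =>
    cases j with
    | zero => simp [vwp, qPoch_zero]
    | succ j =>
      rw [add_zero, vwp, vwp, mul_one, mul_assoc, key, show 2 * (j + 1) = j + (j + 1) + 1 by ring,
        qPoch_succ]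
      ring
  | succ k =>
    rw [← add_assoc, vwp, vwp, mul_assoc, key, show j + k + j = 2 * j + k by ring, qPoch_add]
    ring_nf

lemma qPoch_neg_pow {q : ℂ} (hq : q ≠ 0) (j k : ℕ) :
    qPoch q (q⁻¹ ^ (j + k)) j * qPoch q q k =
      (-q⁻¹) ^ j * q⁻¹ ^ (j * (j - 1) / 2) * qPoch q q (j + k) * (q⁻¹ ^ j) ^ k := by
  have h := qPoch_reflect hq (pow_ne_zero (k + 1) hq) j
  have e : (q ^ (k + 1))⁻¹ * q * q⁻¹ ^ j = q⁻¹ ^ (j + k) := by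
    rw [← inv_pow, pow_succ, inv_mul_cancel_right₀ hq, mul_comm, pow_add]
  rw [e] at h
  have e2 : qPoch q q (j + k) = qPoch q q k * qPoch q (q ^ (k + 1)) j := by
    rw [add_comm, qPoch_add, pow_succ']
  rw [h, e2, ← inv_pow, pow_succ]
  ring

/-- The general term of the double series that results from expanding the factor
`(b, c; q)_n / (aq/b, aq/c; q)_n` of the `₈φ₇` series by the balanced `₃φ₂` sum. -/
noncomputable def doubleTerm (q a b c d e f : ℂ) (n j : ℕ) : ℂ :=
  vwp q a n / qPoch q q n * (qPoch q d n * qPoch q e n * qPoch q f n /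
    (qPoch q (a * q / d) n * qPoch q (a * q / e) n * qPoch q (a * q / f) n)) *
    (a * q / (d * e * f)) ^ n *
    saalTerm q (q⁻¹ ^ n) (a * q ^ n) (a * q / (b * c)) (a * q / b) (a * q / c) j

lemma doubleTerm_of_lt {q : ℂ} (hq : q ≠ 0) (a b c d e f : ℂ) {n j : ℕ} (h : n < j) :
    doubleTerm q a b c d e f n j = 0 := by
  have : qPoch q (q⁻¹ ^ n) j = 0 := qPoch_eq_zero_of_le (m := n + 1)
    (by rw [qPoch_succ, ← mul_pow, inv_mul_cancel₀ hq, one_pow, sub_self, mul_zero]) h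
  rw [doubleTerm, saalTerm, this]
  simp only [zero_mul, zero_div, mul_zero]

/-- The part of `doubleTerm` that depends on the column only. -/
noncomputable def columnFactor (q a b c d e f : ℂ) (j : ℕ) : ℂ :=
  qPoch q (a * q / (b * c)) j / (qPoch q q j * qPoch q (a * q / b) j * qPoch q (a * q / c) j) *
    q ^ j * qPoch q (a * q) (2 * j) * ((-q⁻¹) ^ j * q⁻¹ ^ (j * (j - 1) / 2)) *
    (qPoch q d j * qPoch q e j * qPoch q f j /
    (qPoch q (a * q / d) j * qPoch q (a * q / e) j * qPoch q (a * q / f) j)) *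
    (a * q / (d * e * f)) ^ j

lemma div_shift {q : ℂ} (hq : q ≠ 0) (a x : ℂ) (j : ℕ) :
    a * q ^ (2 * j) * q / (x * q ^ j) = a * q / x * q ^ j := by
  rw [show a * q ^ (2 * j) * q = a * q * q ^ j * q ^ j by ring,
    mul_div_mul_right _ _ (pow_ne_zero _ hq)]
  ring

lemma div_shift₂ {q : ℂ} (hq : q ≠ 0) (a x y : ℂ) (j : ℕ) :
    a * q ^ (2 * j) * q / (x * q ^ j * (y * q ^ j)) = a * q / (x * y) := by
  rw [show a * q ^ (2 * j) * q = a * q * (q ^ j * q ^ j) by ring,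
    show x * q ^ j * (y * q ^ j) = x * y * (q ^ j * q ^ j) by ring,
    mul_div_mul_right _ _ (mul_ne_zero (pow_ne_zero _ hq) (pow_ne_zero _ hq))]

lemma div_shift₃ {q : ℂ} (hq : q ≠ 0) (a x y z : ℂ) (j : ℕ) :
    a * q ^ (2 * j) * q / (x * q ^ j * (y * q ^ j) * (z * q ^ j)) =
      a * q / (x * y * z) * q⁻¹ ^ j := by
  rw [show a * q ^ (2 * j) * q = a * q * (q ^ j * q ^ j) by ring,
    show x * q ^ j * (y * q ^ j) * (z * q ^ j) = x * y * z * q ^ j * (q ^ j * q ^ j) by ring,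
    mul_div_mul_right _ _ (mul_ne_zero (pow_ne_zero _ hq) (pow_ne_zero _ hq)), ← div_div,
    div_eq_mul_inv (_ / _), inv_pow]

/-- With `n = j + k`, the `j`-th column of the double series is a multiple of a `₆φ₅` series in
`k` with parameters `a q ^ (2j)` and `d q ^ j, e q ^ j, f q ^ j`. -/
lemma doubleTerm_add {q : ℂ} (hq : q ≠ 0) (hqn : ∀ k, qPoch q q k ≠ 0) (a b c d e f : ℂ)
    (j k : ℕ) :
    doubleTerm q a b c d e f (j + k) j = columnFactor q a b c d e f j *
      sixTerm q (a * q ^ (2 * j)) (d * q ^ j) (e * q ^ j) (f * q ^ j) k := by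
  have h1 := vwp_mul_qPoch q a j k
  have h2 := qPoch_neg_pow hq j k
  have h3 : vwp q a (j + k) / qPoch q q (j + k) *
      (qPoch q (q⁻¹ ^ (j + k)) j * qPoch q (a * q ^ (j + k)) j) =
      qPoch q (a * q) (2 * j) * ((-q⁻¹) ^ j * q⁻¹ ^ (j * (j - 1) / 2)) *
      (vwp q (a * q ^ (2 * j)) k / qPoch q q k * (q⁻¹ ^ j) ^ k) := by
    have h4 := hqn k
    have h5 := hqn (j + k)
    generalize (-q⁻¹) ^ j * q⁻¹ ^ (j * (j - 1) / 2) = t at *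
    generalize (q⁻¹ ^ j) ^ k = t' at *
    generalize qPoch q (q⁻¹ ^ (j + k)) j = p1 at *
    generalize qPoch q (a * q ^ (j + k)) j = p2 at *
    generalize qPoch q (a * q) (2 * j) = p3 at *
    generalize vwp q (a * q ^ (2 * j)) k = p4 at *
    field_simp
    linear_combination (vwp q a (j + k) * p2) * h2 + (t * qPoch q q (j + k) * t') * h1
  have h6 : doubleTerm q a b c d e f (j + k) j =
      vwp q a (j + k) / qPoch q q (j + k) *
      (qPoch q (q⁻¹ ^ (j + k)) j * qPoch q (a * q ^ (j + k)) j) *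
      (qPoch q d (j + k) * qPoch q e (j + k) * qPoch q f (j + k) / (qPoch q (a * q / d) (j + k) *
        qPoch q (a * q / e) (j + k) * qPoch q (a * q / f) (j + k)) *
        (a * q / (d * e * f)) ^ (j + k) * (qPoch q (a * q / (b * c)) j /
        (qPoch q q j * qPoch q (a * q / b) j * qPoch q (a * q / c) j) * q ^ j)) := by
    rw [doubleTerm, saalTerm]
    generalize q⁻¹ ^ (j + k) = t
    ring
  rw [h6, h3, sixTerm, div_shift hq, div_shift hq, div_shift hq, div_shift₃ hq, columnFactor,
    mul_pow, pow_add (a * q / (d * e * f))]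
  simp only [qPoch_add q _ j k]
  generalize (q⁻¹ ^ j) ^ k = t
  generalize (-q⁻¹) ^ j * q⁻¹ ^ (j * (j - 1) / 2) = t
  generalize a * q / (d * e * f) = z
  ring

/-- Each column of the double series sums, by the `₆φ₅` summation, to a term of the `₄φ₃`
series times the infinite products of the transformation formula. -/
lemma hasSum_doubleTerm {q a b c d e f : ℂ} (hq : q ≠ 0) (hq1 : ‖q‖ < 1) (ha : a ≠ 0)
    (hd : d ≠ 0) (he : e ≠ 0) (hf : f ≠ 0)
    (hdn : ∀ k, qPoch q (a * q / d) k ≠ 0) (hen : ∀ k, qPoch q (a * q / e) k ≠ 0)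
    (hfn : ∀ k, qPoch q (a * q / f) k ≠ 0) (hxn : ∀ k, qPoch q (d * e * f / a) k ≠ 0)
    (hzn : ∀ k, qPoch q (a * q / (d * e * f)) k ≠ 0) (j : ℕ)
    (hsum : Summable fun n => ‖qPoch q (d * q ^ j) n * qPoch q (e * q ^ j) n *
      qPoch q (f * q ^ j) n * (a * q / (d * e * f) * q⁻¹ ^ j) ^ n‖) :
    HasSum (fun n => doubleTerm q a b c d e f n j)
      (qPochInf q (a * q) * (qPochInf q (a * q / (e * f)) * qPochInf q (a * q / (d * f)) *
        qPochInf q (a * q / (d * e))) / (qPochInf q (a * q / d) * qPochInf q (a * q / e) *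
        qPochInf q (a * q / f) * qPochInf q (a * q / (d * e * f))) *
      (qPoch q (a * q / (b * c)) j * (qPoch q d j * qPoch q e j * qPoch q f j) /
        (qPoch q q j * (qPoch q (d * e * f / a) j * qPoch q (a * q / b) j * qPoch q (a * q / c) j))
        * q ^ j)) := by
  have hqj := pow_ne_zero j hq
  -- The infinite product `(aq/(def) q ^ (-j); q)_∞` exceeds `(aq/(def); q)_∞` by `j` factors, which
  -- on reversal become `(def/a; q)_j`.
  have hrefl := qPoch_reflect hq (x := d * e * f / a) (by positivity) j
  rw [inv_div, div_mul_eq_mul_div] at hrefl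
  have hcancel : a * q / (d * e * f) * q⁻¹ ^ j * q ^ j = a * q / (d * e * f) := by
    rw [mul_assoc, ← mul_pow, inv_mul_cancel₀ hq, one_pow, mul_one]
  have hpre : (-(a / (d * e * f))) ^ j * q⁻¹ ^ (j * (j - 1) / 2) ≠ 0 :=
    mul_ne_zero (pow_ne_zero _ (neg_ne_zero.2 (by positivity))) (pow_ne_zero _ (inv_ne_zero hq))
  have hw : qPoch q (a * q / (d * e * f) * q⁻¹ ^ j) j ≠ 0 := by
    rw [hrefl]
    exact mul_ne_zero hpre (hxn j)
  have hadm : SixAdmissible q (a * q ^ (2 * j)) (d * q ^ j) (e * q ^ j) (f * q ^ j) := by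
    refine ⟨?_, ?_, ?_, ?_, ?_⟩
    · rw [div_shift hq]; exact qPoch_shift_ne_zero hdn j
    · rw [div_shift hq]; exact qPoch_shift_ne_zero hen j
    · rw [div_shift hq]; exact qPoch_shift_ne_zero hfn j
    · rw [div_shift₃ hq]
      intro k hk
      refine mul_ne_zero hw (hzn k) ?_
      have := qPoch_eq_zero_of_le hk (Nat.le_add_left k j)
      rwa [qPoch_add, hcancel] at this
    · simpa only [div_shift₃ hq] using hsum
  have h := (hadm.hasSum hq1 (mul_ne_zero hd hqj) (mul_ne_zero he hqj)
    (mul_ne_zero hf hqj)).mul_left (columnFactor q a b c d e f j)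
  simp only [← doubleTerm_add hq (qPoch_self_ne_zero hq1), div_shift hq, div_shift₂ hq,
    div_shift₃ hq] at h
  have hzero : ∑ i ∈ Finset.range j, doubleTerm q a b c d e f i j = 0 :=
    Finset.sum_eq_zero fun i hi => doubleTerm_of_lt hq _ _ _ _ _ _ (Finset.mem_range.1 hi)
  simp only [add_comm j] at h
  rw [hasSum_nat_add_iff (f := fun n => doubleTerm q a b c d e f n j), hzero, add_zero] at h
  refine (congrArg (fun v => HasSum (fun n => doubleTerm q a b c d e f n j) v) ?_).mpr h
  rw [columnFactor, qPochInf_eq_mul hq1 (a * q) (2 * j), qPochInf_eq_mul hq1 (a * q / d) j,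
    qPochInf_eq_mul hq1 (a * q / e) j, qPochInf_eq_mul hq1 (a * q / f) j,
    qPochInf_eq_mul hq1 (a * q / (d * e * f) * q⁻¹ ^ j) j, hcancel, hrefl,
    show a * q ^ (2 * j) * q = a * q * q ^ (2 * j) by ring]
  have e2 : (-q⁻¹) ^ j * q⁻¹ ^ (j * (j - 1) / 2) * (a * q / (d * e * f)) ^ j
      = (-(a / (d * e * f))) ^ j * q⁻¹ ^ (j * (j - 1) / 2) := by
    rw [mul_right_comm, ← mul_pow]
    congr 2
    field_simp
  have e3 : ∀ A B : ℂ, A * ((-q⁻¹) ^ j * q⁻¹ ^ (j * (j - 1) / 2)) * B *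
      (a * q / (d * e * f)) ^ j = A * B * ((-q⁻¹) ^ j * q⁻¹ ^ (j * (j - 1) / 2) *
      (a * q / (d * e * f)) ^ j) := fun A B => by ring
  rw [e3, e2]
  have e4 : ∀ U V W X Y : ℂ, U * ((-(a / (d * e * f))) ^ j * q⁻¹ ^ (j * (j - 1) / 2)) *
      (V / (W * ((-(a / (d * e * f))) ^ j * q⁻¹ ^ (j * (j - 1) / 2) * X * Y))) =
      U * (V / (W * (X * Y))) := fun U V W X Y => by
    rw [mul_assoc U, ← mul_div_assoc, mul_assoc _ X, mul_left_comm W, mul_div_mul_left _ _ hpre]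
  rw [e4]
  ring

/-! ### The rows of the double series and the interchange of summation -/

lemma one_sub_mul_vwp (q a : ℂ) (n : ℕ) :
    (1 - a) * vwp q a n = (1 - a * q ^ (2 * n)) * qPoch q a n := by
  cases n with
  | zero => simp [vwp, qPoch_zero]
  | succ n => rw [vwp, qPoch_succ']; ring

/-- The factors `(a, qs, -qs; q)_n / (s, -s; q)_n` with `s ^ 2 = a` combine to a polynomial. -/
lemma qPoch_div_eq_vwp {q s : ℂ} (h1 : ∀ k, qPoch q s k ≠ 0) (h2 : ∀ k, qPoch q (-s) k ≠ 0)
    (n : ℕ) :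
    qPoch q (s ^ 2) n * (qPoch q (q * s) n * qPoch q (-(q * s)) n) /
      (qPoch q s n * qPoch q (-s) n) = vwp q (s ^ 2) n := by
  have e1 := qPoch_succ' q s n
  have e2 := qPoch_succ' q (-s) n
  rw [qPoch_succ] at e1 e2
  have h3 : 1 - s ≠ 0 := by simpa [qPoch] using h1 1
  have h4 : 1 - -s ≠ 0 := by simpa [qPoch] using h2 1
  have h5 := one_sub_mul_vwp q (s ^ 2) n
  rw [show q * s = s * q by ring, show -(s * q) = -s * q by ring, div_eq_iff
    (mul_ne_zero (h1 n) (h2 n))]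
  have h6 : 1 - s ^ 2 ≠ 0 := by
    have := mul_ne_zero h3 h4
    rwa [show (1 - s) * (1 - -s) = 1 - s ^ 2 by ring] at this
  refine mul_left_cancel₀ h6 ?_
  linear_combination (-(qPoch q s n * qPoch q (-s) n)) * h5
    - qPoch q (s ^ 2) n * (1 + s) * qPoch q (-s * q) n * e1
    - qPoch q (s ^ 2) n * qPoch q s n * (1 - s * q ^ n) * e2

lemma phiTerm_eight {q s : ℂ} (h1 : ∀ k, qPoch q s k ≠ 0) (h2 : ∀ k, qPoch q (-s) k ≠ 0)
    (b c d e f b' c' d' e' f' z : ℂ) (n : ℕ) :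
    phiTerm [s ^ 2, q * s, -(q * s), b, c, d, e, f] [s, -s, b', c', d', e', f'] q z n =
      vwp q (s ^ 2) n / qPoch q q n * (qPoch q d n * qPoch q e n * qPoch q f n /
        (qPoch q d' n * qPoch q e' n * qPoch q f' n)) *
        (qPoch q b n * qPoch q c n / (qPoch q b' n * qPoch q c' n)) * z ^ n := by
  rw [← qPoch_div_eq_vwp h1 h2]
  simp only [phiTerm, qPochs, List.map_cons, List.map_nil, List.prod_cons, List.prod_nil,
    List.length_cons, List.length_nil]
  norm_num
  left
  ring

lemma phiTerm_four (q a b c d e f g : ℂ) (n : ℕ) :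
    phiTerm [a, b, c, d] [e, f, g] q q n =
      qPoch q a n * (qPoch q b n * qPoch q c n * qPoch q d n) /
        (qPoch q q n * (qPoch q e n * qPoch q f n * qPoch q g n)) * q ^ n := by
  simp only [phiTerm, qPochs, List.map_cons, List.map_nil, List.prod_cons, List.prod_nil,
    List.length_cons, List.length_nil]
  norm_num
  left
  ring

/-- Each row of the double series sums, by the `q`-Saalschütz summation, to a term of the `₈φ₇`
series. -/
lemma sum_doubleTerm {q a b c : ℂ} (hq : q ≠ 0) (hq1 : ‖q‖ < 1) (ha : a ≠ 0) (hb : b ≠ 0)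
    (hc : c ≠ 0) (hbn : ∀ k, qPoch q (a * q / b) k ≠ 0) (hcn : ∀ k, qPoch q (a * q / c) k ≠ 0)
    (d e f : ℂ) (n : ℕ) :
    ∑ j ∈ Finset.range (n + 1), doubleTerm q a b c d e f n j =
      vwp q a n / qPoch q q n * (qPoch q d n * qPoch q e n * qPoch q f n /
        (qPoch q (a * q / d) n * qPoch q (a * q / e) n * qPoch q (a * q / f) n)) *
        (qPoch q b n * qPoch q c n / (qPoch q (a * q / b) n * qPoch q (a * q / c) n)) *
        (a ^ 2 * q ^ 2 / (b * c * d * e * f)) ^ n := by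
  simp only [doubleTerm]
  rw [← Finset.mul_sum, saalschutz hq (qPoch_self_ne_zero hq1) n a b c ha hb hc hbn hcn,
    show a ^ 2 * q ^ 2 / (b * c * d * e * f) = a * q / (d * e * f) * (a * q / (b * c)) by
      rw [div_mul_div_comm]; ring_nf, mul_pow]
  ring

lemma exists_pow_eq_one_of_qPoch_eq_zero {q x : ℂ} {n : ℕ} (h : qPoch q x n = 0) :
    ∃ m, x * q ^ m = 1 := by
  obtain ⟨m, -, hm⟩ := Finset.prod_eq_zero_iff.1 h
  exact ⟨m, (sub_eq_zero.1 hm).symm⟩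

lemma qPoch_eq_zero_of_pow_eq_one {q x : ℂ} {m : ℕ} (h : x * q ^ m = 1) :
    qPoch q x (m + 1) = 0 := by
  rw [qPoch_succ, h, sub_self, mul_zero]

/-- If one of `d, e, f` makes the series terminate, then so do the shifted series in the columns
in which `(d, e, f; q)_j` does not vanish. -/
lemma summable_column_of_terminating {q d e f : ℂ} {M j : ℕ}
    (hM : qPoch q d M * qPoch q e M * qPoch q f M = 0)
    (hj : qPoch q d j * qPoch q e j * qPoch q f j ≠ 0) (z : ℂ) :
    Summable fun n => ‖qPoch q (d * q ^ j) n * qPoch q (e * q ^ j) n *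
      qPoch q (f * q ^ j) n * z ^ n‖ := by
  refine summable_of_ne_finset_zero (s := Finset.range M) fun n hn => ?_
  have hn : M ≤ n := by simpa using hn
  have key : ∀ x, qPoch q x M = 0 → qPoch q x j ≠ 0 → qPoch q (x * q ^ j) n = 0 := by
    intro x h1 h2
    have := qPoch_eq_zero_of_le h1 (hn.trans (Nat.le_add_left n j))
    rw [qPoch_add] at this
    exact (mul_eq_zero.1 this).resolve_left h2
  have hj1 := left_ne_zero_of_mul (left_ne_zero_of_mul hj)
  have hj2 := right_ne_zero_of_mul (left_ne_zero_of_mul hj)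
  have hj3 := right_ne_zero_of_mul hj
  rcases mul_eq_zero.1 hM with h | h
  · rcases mul_eq_zero.1 h with h | h
    · simp [key d h hj1]
    · simp [key e h hj2]
  · simp [key f h hj3]

lemma summable_column_of_norm_lt_one {q : ℂ} (hq : ‖q‖ < 1) (d e f : ℂ) {z : ℂ} (hz : ‖z‖ < 1) :
    Summable fun n => ‖qPoch q d n * qPoch q e n * qPoch q f n * z ^ n‖ := by
  obtain ⟨M1, h1, h1'⟩ := exists_norm_qPoch_le_uniform hq d
  obtain ⟨M2, h2, h2'⟩ := exists_norm_qPoch_le_uniform hq e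
  obtain ⟨M3, h3, h3'⟩ := exists_norm_qPoch_le_uniform hq f
  refine ((summable_geometric_of_lt_one (norm_nonneg z) hz).mul_left (M1 * M2 * M3)).of_nonneg_of_le
    (fun _ => norm_nonneg _) fun n => ?_
  rw [norm_mul, norm_mul, norm_mul, norm_pow]
  gcongr
  exacts [h1' d n le_rfl, h2' e n le_rfl, h3' f n le_rfl]

/-- Interchange of summation: the transformation formula whenever every column of the double
series converges. -/
lemma hasSum_eight {q s b c d e f : ℂ} (hq : q ≠ 0) (hq1 : ‖q‖ < 1) (hs : s ≠ 0)
    (hb : b ≠ 0) (hc : c ≠ 0) (hd : d ≠ 0) (he : e ≠ 0) (hf : f ≠ 0)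
    (hs1 : ∀ k, qPoch q s k ≠ 0) (hs2 : ∀ k, qPoch q (-s) k ≠ 0)
    (hbn : ∀ k, qPoch q (s ^ 2 * q / b) k ≠ 0) (hcn : ∀ k, qPoch q (s ^ 2 * q / c) k ≠ 0)
    (hdn : ∀ k, qPoch q (s ^ 2 * q / d) k ≠ 0) (hen : ∀ k, qPoch q (s ^ 2 * q / e) k ≠ 0)
    (hfn : ∀ k, qPoch q (s ^ 2 * q / f) k ≠ 0) (hxn : ∀ k, qPoch q (d * e * f / s ^ 2) k ≠ 0)
    (hzn : ∀ k, qPoch q (s ^ 2 * q / (d * e * f)) k ≠ 0) {J : ℕ}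
    (hJ : qPoch q (s ^ 2 * q / (b * c)) J * (qPoch q d J * qPoch q e J * qPoch q f J) = 0)
    (hsum : ∀ j, qPoch q (s ^ 2 * q / (b * c)) j ≠ 0 → qPoch q d j * qPoch q e j * qPoch q f j ≠ 0 →
      Summable fun n => ‖qPoch q (d * q ^ j) n * qPoch q (e * q ^ j) n *
      qPoch q (f * q ^ j) n * (s ^ 2 * q / (d * e * f) * q⁻¹ ^ j) ^ n‖) :
    HasSum (phiTerm [s ^ 2, q * s, -(q * s), b, c, d, e, f]
        [s, -s, s ^ 2 * q / b, s ^ 2 * q / c, s ^ 2 * q / d, s ^ 2 * q / e, s ^ 2 * q / f]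
        q ((s ^ 2) ^ 2 * q ^ 2 / (b * c * d * e * f)))
      (qPochsInf q [s ^ 2 * q, s ^ 2 * q / (e * f), s ^ 2 * q / (d * f), s ^ 2 * q / (d * e)] /
          qPochsInf q
            [s ^ 2 * q / d, s ^ 2 * q / e, s ^ 2 * q / f, s ^ 2 * q / (d * e * f)] *
        phi [s ^ 2 * q / (b * c), d, e, f]
          [d * e * f / s ^ 2, s ^ 2 * q / b, s ^ 2 * q / c] q q) := by
  have ha : s ^ 2 ≠ 0 := pow_ne_zero 2 hs
  generalize ha' : s ^ 2 = a at *
  have hvan : ∀ j, J ≤ j →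
      qPoch q (a * q / (b * c)) j = 0 ∨ qPoch q d j * qPoch q e j * qPoch q f j = 0 := by
    intro j hj
    simp only [mul_eq_zero] at hJ ⊢
    rcases hJ with h | (h | h) | h <;> simp [qPoch_eq_zero_of_le h hj]
  have hdouble : ∀ n j, qPoch q (a * q / (b * c)) j = 0 ∨
      qPoch q d j * qPoch q e j * qPoch q f j = 0 → doubleTerm q a b c d e f n j = 0 := by
    intro n j h
    rcases lt_or_ge n j with hn | hn
    · exact doubleTerm_of_lt hq _ _ _ _ _ _ hn
    rcases h with h | h
    · rw [doubleTerm, saalTerm, h]; ring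
    · have : qPoch q d n * qPoch q e n * qPoch q f n = 0 := by
        simp only [mul_eq_zero] at h ⊢
        rcases h with (h | h) | h <;> simp [qPoch_eq_zero_of_le h hn]
      rw [doubleTerm, this]; ring
  have hcol : ∀ j, HasSum (fun n => doubleTerm q a b c d e f n j)
      (qPochsInf q [a * q, a * q / (e * f), a * q / (d * f), a * q / (d * e)] /
          qPochsInf q [a * q / d, a * q / e, a * q / f, a * q / (d * e * f)] *
        phiTerm [a * q / (b * c), d, e, f] [d * e * f / a, a * q / b, a * q / c] q q j) := by
    intro j
    rw [phiTerm_four]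
    by_cases h : qPoch q (a * q / (b * c)) j = 0 ∨ qPoch q d j * qPoch q e j * qPoch q f j = 0
    · have e0 : qPoch q (a * q / (b * c)) j * (qPoch q d j * qPoch q e j * qPoch q f j) = 0 := by
        rcases h with h | h <;> rw [h] <;> ring
      simp only [hdouble _ j h, e0, zero_div, zero_mul, mul_zero]
      exact hasSum_zero
    · push Not at h
      have := hasSum_doubleTerm (b := b) (c := c) hq hq1 ha hd he hf hdn hen hfn hxn hzn j
        (hsum j h.1 h.2)
      simpa only [qPochsInf, List.map_cons, List.map_nil, List.prod_cons, List.prod_nil, mul_one,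
        mul_assoc] using this
  have hrow : ∀ n, ∑ j ∈ Finset.range J, doubleTerm q a b c d e f n j =
      phiTerm [a, q * s, -(q * s), b, c, d, e, f]
        [s, -s, a * q / b, a * q / c, a * q / d, a * q / e, a * q / f]
        q (a ^ 2 * q ^ 2 / (b * c * d * e * f)) n := by
    intro n
    subst ha'
    rw [phiTerm_eight hs1 hs2, ← sum_doubleTerm hq hq1 ha hb hc hbn hcn]
    rcases le_total J (n + 1) with h | h
    · refine Finset.sum_subset (Finset.range_subset_range.2 h) fun j _ hj => ?_
      exact hdouble n j (hvan j (by simpa using hj))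
    · refine (Finset.sum_subset (Finset.range_subset_range.2 h) fun j _ hj => ?_).symm
      exact doubleTerm_of_lt hq _ _ _ _ _ _ (by simpa using hj)
  have hphi : phi [a * q / (b * c), d, e, f] [d * e * f / a, a * q / b, a * q / c] q q =
      ∑ j ∈ Finset.range J,
        phiTerm [a * q / (b * c), d, e, f] [d * e * f / a, a * q / b, a * q / c] q q j := by
    refine tsum_eq_sum fun j hj => ?_
    rw [phiTerm_four]
    rcases hvan j (by simpa using hj) with h | h <;> rw [h] <;> ring
  rw [hphi, Finset.mul_sum, ← funext hrow]
  exact hasSum_sum fun j _ => hcol j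

/-! ### Vanishing for `a = q ^ (-k)` -/

/-- The quotient `(x; q)_i / (aq/x; q)_i` for `a = q ^ (-(i + j))`, suitably normalised, is
symmetric in `i` and `j`. -/
lemma wellPoised_symm {q x a : ℂ} (hq : q ≠ 0) (hx : x ≠ 0) {i j : ℕ} (ha : a * q ^ (i + j) = 1)
    (h : ∀ k, qPoch q (a * q / x) k ≠ 0) :
    qPoch q x i / qPoch q (a * q / x) i * ((-x⁻¹) ^ i * q⁻¹ ^ (i * (i - 1) / 2)) =
      qPoch q x j / qPoch q (a * q / x) j * ((-x⁻¹) ^ j * q⁻¹ ^ (j * (j - 1) / 2)) := by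
  have key : ∀ i j : ℕ, a * q ^ (i + j) = 1 → qPoch q (a * q / x) i * qPoch q x j =
      qPoch q x (i + j) * ((-x⁻¹) ^ i * q⁻¹ ^ (i * (i - 1) / 2)) * (q⁻¹ ^ (i * j)) := by
    intro i j ha
    have hr := qPoch_reflect hq (x := x * q ^ j) (by positivity) i
    have e1 : (x * q ^ j)⁻¹ * q * q⁻¹ ^ i = a * q / x := by
      have : a = (q ^ (i + j))⁻¹ := eq_inv_of_mul_eq_one_left ha
      rw [this]
      simp only [inv_pow]
      field_simp
      ring
    rw [e1] at hr
    rw [hr, add_comm i j, qPoch_add, mul_inv, ← inv_pow, ← neg_mul, mul_pow, ← pow_mul,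
      mul_comm j i]
    ring
  have h1 := key i j ha
  have h2 := key j i (by rwa [add_comm])
  rw [add_comm j i, mul_comm j i] at h2
  rw [div_mul_eq_mul_div, div_mul_eq_mul_div, div_eq_div_iff (h i) (h j)]
  have h3 : q⁻¹ ^ (i * j) ≠ 0 := by positivity
  have h4 : qPoch q x (i + j) ≠ 0 := by
    have := key (i + j) 0 (by simpa using ha)
    rw [add_zero, qPoch_zero, mul_one] at this
    exact left_ne_zero_of_mul (left_ne_zero_of_mul (this ▸ h _))
  refine mul_right_cancel₀ (mul_ne_zero h4 h3) ?_
  linear_combination (-(qPoch q x i * qPoch q (a * q / x) j)) * h1 +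
    (qPoch q x j * qPoch q (a * q / x) i) * h2

/-- For `a = q ^ (-(i + j))` the power of the argument of the `₈φ₇` series and the normalising
factors of six well-poised quotients agree up to `q ^ (-3ij - i)`, whose only part not symmetric in
`i` and `j` is `q ^ (-i)`. -/
lemma pow_wellPoised {q a : ℂ} (hq : q ≠ 0) {i j : ℕ} (ha : a * q ^ (i + j) = 1) :
    (a ^ 3 * q ^ 2) ^ i = (q⁻¹ ^ (i * (i - 1) / 2)) ^ 6 * q⁻¹ ^ (3 * (i * j) + i) := by
  have hw : i * (i - 1) / 2 * 2 + i = i * i := by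
    rw [Nat.div_mul_cancel (Nat.even_mul_pred_self i).two_dvd]
    rcases i with _ | i
    · rfl
    · simp; ring
  have ha' : a = q⁻¹ ^ (i + j) := by rw [inv_pow]; exact eq_inv_of_mul_eq_one_left ha
  have hp : q⁻¹ ^ (2 * i) ≠ 0 := pow_ne_zero _ (inv_ne_zero hq)
  refine mul_right_cancel₀ hp ?_
  have h1 : (a ^ 3 * q ^ 2) ^ i * q⁻¹ ^ (2 * i) = a ^ (3 * i) := by
    rw [mul_pow, ← pow_mul, ← pow_mul, mul_assoc, ← mul_pow, mul_inv_cancel₀ hq, one_pow, mul_one]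
  rw [h1, ha', ← pow_mul, ← pow_mul, ← pow_add, ← pow_add]
  congr 1
  linear_combination 3 * hw.symm

/-- Reversing the order of summation changes the sign of the terms of the `₈φ₇` series with
`a = q ^ (-(i + j))`. -/
lemma eight_antisymm {q a b c d e f : ℂ} (hq : q ≠ 0) (hqn : ∀ k, qPoch q q k ≠ 0)
    (ha : a ≠ 0) (hb : b ≠ 0) (hc : c ≠ 0) (hd : d ≠ 0) (he : e ≠ 0) (hf : f ≠ 0)
    (ha1 : 1 - a ≠ 0)
    (hbn : ∀ k, qPoch q (a * q / b) k ≠ 0) (hcn : ∀ k, qPoch q (a * q / c) k ≠ 0)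
    (hdn : ∀ k, qPoch q (a * q / d) k ≠ 0) (hen : ∀ k, qPoch q (a * q / e) k ≠ 0)
    (hfn : ∀ k, qPoch q (a * q / f) k ≠ 0) {T : ℕ → ℂ}
    (hT : ∀ n, T n = vwp q a n / qPoch q q n * (qPoch q d n * qPoch q e n * qPoch q f n /
        (qPoch q (a * q / d) n * qPoch q (a * q / e) n * qPoch q (a * q / f) n)) *
        (qPoch q b n * qPoch q c n / (qPoch q (a * q / b) n * qPoch q (a * q / c) n)) *
        (a ^ 2 * q ^ 2 / (b * c * d * e * f)) ^ n)
    {i j : ℕ} (hij : a * q ^ (i + j) = 1) : T i = -T j := by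
  have hji : a * q ^ (j + i) = 1 := by rwa [add_comm]
  have haq : a * q / a = q := mul_div_cancel_left₀ q ha
  set V : ℕ → ℂ := fun n => qPoch q a n / qPoch q (a * q / a) n *
    (qPoch q b n / qPoch q (a * q / b) n) * (qPoch q c n / qPoch q (a * q / c) n) *
    (qPoch q d n / qPoch q (a * q / d) n) * (qPoch q e n / qPoch q (a * q / e) n) *
    (qPoch q f n / qPoch q (a * q / f) n) with hV
  set X : ℂ := (a * b * c * d * e * f)⁻¹ with hX
  have hTV : ∀ n, (1 - a) * T n = (1 - a * q ^ (2 * n)) * (V n * X ^ n * (a ^ 3 * q ^ 2) ^ n) := by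
    intro n
    have hz : a ^ 2 * q ^ 2 / (b * c * d * e * f) = X * (a ^ 3 * q ^ 2) := by
      rw [hX]; field_simp
    rw [hT, hz, mul_pow, hV]
    simp only [haq]
    have := one_sub_mul_vwp q a n
    generalize a ^ 3 * q ^ 2 = r
    linear_combination (1 / qPoch q q n * (qPoch q d n * qPoch q e n * qPoch q f n /
        (qPoch q (a * q / d) n * qPoch q (a * q / e) n * qPoch q (a * q / f) n)) *
        (qPoch q b n * qPoch q c n / (qPoch q (a * q / b) n * qPoch q (a * q / c) n)) *
        (X ^ n * r ^ n)) * this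
  have hsym : V i * X ^ i * (q⁻¹ ^ (i * (i - 1) / 2)) ^ 6 =
      V j * X ^ j * (q⁻¹ ^ (j * (j - 1) / 2)) ^ 6 := by
    have key : ∀ n, V n * X ^ n * (q⁻¹ ^ (n * (n - 1) / 2)) ^ 6 =
        (qPoch q a n / qPoch q (a * q / a) n * ((-a⁻¹) ^ n * q⁻¹ ^ (n * (n - 1) / 2))) *
        (qPoch q b n / qPoch q (a * q / b) n * ((-b⁻¹) ^ n * q⁻¹ ^ (n * (n - 1) / 2))) *
        (qPoch q c n / qPoch q (a * q / c) n * ((-c⁻¹) ^ n * q⁻¹ ^ (n * (n - 1) / 2))) *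
        (qPoch q d n / qPoch q (a * q / d) n * ((-d⁻¹) ^ n * q⁻¹ ^ (n * (n - 1) / 2))) *
        (qPoch q e n / qPoch q (a * q / e) n * ((-e⁻¹) ^ n * q⁻¹ ^ (n * (n - 1) / 2))) *
        (qPoch q f n / qPoch q (a * q / f) n * ((-f⁻¹) ^ n * q⁻¹ ^ (n * (n - 1) / 2))) := by
      intro n
      have : X ^ n = (-a⁻¹) ^ n * (-b⁻¹) ^ n * (-c⁻¹) ^ n * (-d⁻¹) ^ n * (-e⁻¹) ^ n *
          (-f⁻¹) ^ n := by
        simp only [← mul_pow]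
        congr 1
        rw [hX]
        simp only [mul_inv]
        ring
      rw [this, hV]
      simp only
      generalize q⁻¹ ^ (n * (n - 1) / 2) = w
      ring
    rw [key, key, wellPoised_symm hq ha hij (by rwa [haq]), wellPoised_symm hq hb hij hbn,
      wellPoised_symm hq hc hij hcn, wellPoised_symm hq hd hij hdn,
      wellPoised_symm hq he hij hen, wellPoised_symm hq hf hij hfn]
  have ha' : a = q⁻¹ ^ (i + j) := by rw [inv_pow]; exact eq_inv_of_mul_eq_one_left hij
  have hi : q⁻¹ ^ i * q ^ i = 1 := by rw [← mul_pow, inv_mul_cancel₀ hq, one_pow]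
  have hj : q⁻¹ ^ j * q ^ j = 1 := by rw [← mul_pow, inv_mul_cancel₀ hq, one_pow]
  have e1 : 1 - a * q ^ (2 * i) = 1 - q⁻¹ ^ j * q ^ i := by
    rw [ha', pow_add, two_mul, pow_add]
    linear_combination (-(q⁻¹ ^ j * q ^ i)) * hi
  have e2 : 1 - a * q ^ (2 * j) = 1 - q⁻¹ ^ i * q ^ j := by
    rw [ha', pow_add, two_mul, pow_add]
    linear_combination (-(q⁻¹ ^ i * q ^ j)) * hj
  refine mul_left_cancel₀ ha1 ?_
  rw [mul_neg, hTV, hTV, pow_wellPoised hq hij, pow_wellPoised hq hji, ← mul_assoc (V i * _),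
    ← mul_assoc (V j * _), hsym, e1, e2, mul_comm j i, pow_add _ _ i, pow_add _ _ j]
  generalize V j * X ^ j * (q⁻¹ ^ (j * (j - 1) / 2)) ^ 6 = t
  linear_combination (-(t * q⁻¹ ^ (3 * (i * j)) * q⁻¹ ^ j)) * hi -
    (t * q⁻¹ ^ (3 * (i * j)) * q⁻¹ ^ i) * hj

/-- If `a = q ^ (-k)`, both sides of the transformation formula vanish. -/
lemma hasSum_eight_zero {q s b c d e f : ℂ} (hq : q ≠ 0) (hq1 : ‖q‖ < 1) (hs : s ≠ 0)
    (hb : b ≠ 0) (hc : c ≠ 0) (hd : d ≠ 0) (he : e ≠ 0) (hf : f ≠ 0)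
    (hs1 : ∀ k, qPoch q s k ≠ 0) (hs2 : ∀ k, qPoch q (-s) k ≠ 0)
    (hbn : ∀ k, qPoch q (s ^ 2 * q / b) k ≠ 0) (hcn : ∀ k, qPoch q (s ^ 2 * q / c) k ≠ 0)
    (hdn : ∀ k, qPoch q (s ^ 2 * q / d) k ≠ 0) (hen : ∀ k, qPoch q (s ^ 2 * q / e) k ≠ 0)
    (hfn : ∀ k, qPoch q (s ^ 2 * q / f) k ≠ 0) {k : ℕ} (hk : s ^ 2 * q ^ k = 1) :
    HasSum (phiTerm [s ^ 2, q * s, -(q * s), b, c, d, e, f]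
        [s, -s, s ^ 2 * q / b, s ^ 2 * q / c, s ^ 2 * q / d, s ^ 2 * q / e, s ^ 2 * q / f]
        q ((s ^ 2) ^ 2 * q ^ 2 / (b * c * d * e * f))) 0 ∧ qPochInf q (s ^ 2 * q) = 0 := by
  have ha1 : 1 - s ^ 2 ≠ 0 := by
    have h3 : 1 - s ≠ 0 := by simpa [qPoch] using hs1 1
    have h4 : 1 - -s ≠ 0 := by simpa [qPoch] using hs2 1
    have := mul_ne_zero h3 h4
    rwa [show (1 - s) * (1 - -s) = 1 - s ^ 2 by ring] at this
  have hpoch : qPoch q (s ^ 2 * q) k = 0 := by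
    have := qPoch_eq_zero_of_pow_eq_one hk
    rw [qPoch_succ'] at this
    exact (mul_eq_zero.1 this).resolve_left ha1
  refine ⟨?_, by rw [qPochInf_eq_mul hq1 _ k, hpoch, zero_mul]⟩
  set T := phiTerm [s ^ 2, q * s, -(q * s), b, c, d, e, f]
        [s, -s, s ^ 2 * q / b, s ^ 2 * q / c, s ^ 2 * q / d, s ^ 2 * q / e, s ^ 2 * q / f]
        q ((s ^ 2) ^ 2 * q ^ 2 / (b * c * d * e * f)) with hTdef
  have hT := phiTerm_eight hs1 hs2 b c d e f (s ^ 2 * q / b) (s ^ 2 * q / c) (s ^ 2 * q / d)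
    (s ^ 2 * q / e) (s ^ 2 * q / f) ((s ^ 2) ^ 2 * q ^ 2 / (b * c * d * e * f))
  rw [← hTdef] at hT
  have hanti := fun i j => eight_antisymm (T := T) (i := i) (j := j) hq (qPoch_self_ne_zero hq1)
    (pow_ne_zero 2 hs) hb hc hd he hf ha1 hbn hcn hdn hen hfn hT
  have hsum : ∑ n ∈ Finset.range (k + 1), T n = 0 := by
    have h1 := Finset.sum_range_reflect T (k + 1)
    have h2 : ∑ n ∈ Finset.range (k + 1), T (k + 1 - 1 - n) =
        -∑ n ∈ Finset.range (k + 1), T n := by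
      rw [← Finset.sum_neg_distrib]
      refine Finset.sum_congr rfl fun n hn => hanti _ _ ?_
      rwa [show k + 1 - 1 - n + n = k by have := Finset.mem_range.1 hn; omega]
    rw [h2] at h1
    exact self_eq_neg.1 h1.symm
  rw [← hsum]
  refine hasSum_sum_of_ne_finset_zero fun n hn => ?_
  obtain ⟨m, rfl⟩ : ∃ m, n = m + 1 :=
    Nat.exists_eq_succ_of_ne_zero fun h => hn (by simp [h])
  have hm : k ≤ m := by simp at hn; omega
  rw [hT, vwp, qPoch_eq_zero_of_le hpoch hm]
  ring

/-! ### The transformation formula -/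

lemma DenomNeZero.qPoch_ne_zero {q : ℂ} {bs : List ℂ} (h : DenomNeZero q bs) {x : ℂ}
    (hx : x ∈ bs) (n : ℕ) : qPoch q x n ≠ 0 := fun h0 =>
  h n (List.prod_eq_zero (List.mem_map.2 ⟨x, List.mem_cons_of_mem q hx, h0⟩))

end BasicHyp

open BasicHyp

theorem mainTheorem9 (q a s b c d e f : ℂ) (hq : ‖q‖ < 1)
    -- `s` is either one of the square roots of `a`
    (hs : s ^ 2 = a)
    (ha : a ≠ 0) (hb : b ≠ 0) (hc : c ≠ 0) (hd : d ≠ 0) (he : e ≠ 0) (hf : f ≠ 0)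
    -- no denominator in the formula vanishes
    (h8 : BasicHyp.DenomNeZero q
      [s, -s, a * q / b, a * q / c, a * q / d, a * q / e, a * q / f])
    (h4 : BasicHyp.DenomNeZero q [d * e * f / a, a * q / b, a * q / c])
    (hP : BasicHyp.qPochsInf q
      [a * q / d, a * q / e, a * q / f, a * q / (d * e * f)] ≠ 0)
    -- the usual condition for the convergence of the series on the left
    (hz : ‖a ^ 2 * q ^ 2 / (b * c * d * e * f)‖ < 1 ∨
      BasicHyp.Terminates q [a, q * s, -(q * s), b, c, d, e, f])
    -- the series on the right terminates
    (hterm : BasicHyp.Terminates q [a * q / (b * c), d, e, f]) :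
    Summable (BasicHyp.phiTerm [a, q * s, -(q * s), b, c, d, e, f]
        [s, -s, a * q / b, a * q / c, a * q / d, a * q / e, a * q / f]
        q (a ^ 2 * q ^ 2 / (b * c * d * e * f))) ∧
      BasicHyp.phi [a, q * s, -(q * s), b, c, d, e, f]
          [s, -s, a * q / b, a * q / c, a * q / d, a * q / e, a * q / f]
          q (a ^ 2 * q ^ 2 / (b * c * d * e * f)) =
        BasicHyp.qPochsInf q
            [a * q, a * q / (e * f), a * q / (d * f), a * q / (d * e)] /
          BasicHyp.qPochsInf q
            [a * q / d, a * q / e, a * q / f, a * q / (d * e * f)] *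
        BasicHyp.phi [a * q / (b * c), d, e, f]
          [d * e * f / a, a * q / b, a * q / c] q q := by

  subst hs
  have hs : s ≠ 0 := fun h => ha (by rw [h]; ring)
  rcases eq_or_ne q 0 with rfl | hq0
  · -- For `q = 0` both arguments vanish, and both series reduce to their initial term `1`.
    have h8' : ∀ n, phiTerm [s ^ 2, 0 * s, -(0 * s), b, c, d, e, f] [s, -s, s ^ 2 * 0 / b,
        s ^ 2 * 0 / c, s ^ 2 * 0 / d, s ^ 2 * 0 / e, s ^ 2 * 0 / f] 0
        ((s ^ 2) ^ 2 * 0 ^ 2 / (b * c * d * e * f)) n = if n = 0 then 1 else 0 := by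
      intro n
      rcases n with _ | n <;> simp [phiTerm, qPochs, qPoch]
    have h4' : ∀ n, phiTerm [s ^ 2 * 0 / (b * c), d, e, f]
        [d * e * f / s ^ 2, s ^ 2 * 0 / b, s ^ 2 * 0 / c] 0 0 n = if n = 0 then 1 else 0 := by
      intro n
      rcases n with _ | n <;> simp [phiTerm, qPochs, qPoch]
    rw [phi, phi, funext h8', funext h4', tsum_ite_eq]
    refine ⟨(hasSum_ite_eq 0 1).summable, ?_⟩
    simp [qPochsInf, qPochInf]
  have hs1 := h8.qPoch_ne_zero (x := s) (by simp)
  have hs2 := h8.qPoch_ne_zero (x := -s) (by simp)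
  have hbn := h8.qPoch_ne_zero (x := s ^ 2 * q / b) (by simp)
  have hcn := h8.qPoch_ne_zero (x := s ^ 2 * q / c) (by simp)
  have hdn := h8.qPoch_ne_zero (x := s ^ 2 * q / d) (by simp)
  have hen := h8.qPoch_ne_zero (x := s ^ 2 * q / e) (by simp)
  have hfn := h8.qPoch_ne_zero (x := s ^ 2 * q / f) (by simp)
  have hxn := h4.qPoch_ne_zero (x := d * e * f / s ^ 2) (by simp)
  have hzn : ∀ k, qPoch q (s ^ 2 * q / (d * e * f)) k ≠ 0 := by
    refine qPoch_ne_zero_of_qPochInf hq fun h => hP ?_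
    simp [qPochsInf, h]
  obtain ⟨J, hJ⟩ := hterm
  have hJ : qPoch q (s ^ 2 * q / (b * c)) J * (qPoch q d J * qPoch q e J * qPoch q f J) = 0 := by
    rw [← hJ]
    simp [qPochs, mul_assoc]
  have hmain := hasSum_eight hq0 hq hs hb hc hd he hf hs1 hs2 hbn hcn hdn hen hfn hxn hzn hJ
  by_cases hdef : ∃ M, qPoch q d M * qPoch q e M * qPoch q f M = 0
  · obtain ⟨M, hM⟩ := hdef
    have := hmain fun j _ hj => summable_column_of_terminating hM hj _
    exact ⟨this.summable, this.tsum_eq⟩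
  push Not at hdef
  obtain ⟨m, hm⟩ := exists_pow_eq_one_of_qPoch_eq_zero
    ((mul_eq_zero.1 hJ).resolve_right (hdef J))
  rcases hz with hz | ⟨N, hN⟩
  · -- Here `aq/(bc) = q ^ (-m)`, and only the columns `j ≤ m` contribute; the argument of the
    -- `₆φ₅` series in column `j` is `q ^ (m - j)` times that of the `₈φ₇` series.
    have := hmain fun j hj _ => summable_column_of_norm_lt_one hq _ _ _ (by
      have hjm : j ≤ m := by
        by_contra! h
        exact hj (qPoch_eq_zero_of_le (qPoch_eq_zero_of_pow_eq_one hm) h)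
      have e1 : s ^ 2 * q / (d * e * f) * q⁻¹ ^ j =
          (s ^ 2) ^ 2 * q ^ 2 / (b * c * d * e * f) * q ^ (m - j) := by
        have e2 : q ^ (m - j) = q ^ m * q⁻¹ ^ j := by
          rw [inv_pow, ← div_eq_mul_inv, pow_sub₀ q hq0 hjm, div_eq_mul_inv]
        rw [e2]
        have e3 : (s ^ 2) ^ 2 * q ^ 2 / (b * c * d * e * f) =
            s ^ 2 * q / (d * e * f) * (s ^ 2 * q / (b * c)) := by
          rw [div_mul_div_comm]; ring_nf
        rw [e3]
        linear_combination (-(s ^ 2 * q / (d * e * f) * q⁻¹ ^ j)) * hm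
      rw [e1]
      exact (norm_mul_pow_le hq _ _).trans_lt hz)
    exact ⟨this.summable, this.tsum_eq⟩
  · -- The remaining possibility is that the `₈φ₇` series terminates because of `a`.
    have hqs : ∀ t, (∀ k, qPoch q t k ≠ 0) → qPoch q (q * t) N ≠ 0 := fun t ht h => by
      refine ht (N + 1) ?_
      rw [qPoch_succ', mul_comm t q, h, mul_zero]
    have hqs1 := hqs s hs1
    have hqs2 := hqs (-s) hs2
    rw [mul_neg] at hqs2
    -- `b = q ^ (-n)` and `aq/(bc) = q ^ (-m)` would give `aq/c = q ^ (-(m + n))`.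
    have hbc : ∀ x y, x ≠ 0 → s ^ 2 * q / (x * y) * q ^ m = 1 →
        (∀ k, qPoch q (s ^ 2 * q / y) k ≠ 0) → qPoch q x N ≠ 0 := fun x y hx hxy hy h => by
      obtain ⟨n, hn⟩ := exists_pow_eq_one_of_qPoch_eq_zero h
      refine hy (m + n + 1) (qPoch_eq_zero_of_pow_eq_one ?_)
      have : s ^ 2 * q / y = s ^ 2 * q / (x * y) * x := by
        rw [← div_div, div_right_comm, div_mul_cancel₀ _ hx]
      rw [this, pow_add]
      linear_combination (x * q ^ n) * hxy + hn
    have hbN := hbc b c hb hm hcn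
    have hcN := hbc c b hc (by rwa [mul_comm c b]) hbn
    have haN : qPoch q (s ^ 2) N = 0 := by
      have h1 := hdef N
      simp only [mul_ne_zero_iff] at h1
      simpa [qPochs, hqs1, hqs2, hbN, hcN, h1.1.1, h1.1.2, h1.2] using hN
    obtain ⟨k, hk⟩ := exists_pow_eq_one_of_qPoch_eq_zero haN
    obtain ⟨h1, h2⟩ := hasSum_eight_zero hq0 hq hs hb hc hd he hf hs1 hs2 hbn hcn hdn hen hfn hk
    refine ⟨h1.summable, ?_⟩
    rw [phi, h1.tsum_eq]
    simp [qPochsInf, h2]
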